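/- Let $A$ be a complete Noetherian local ring of dimension $d \ge 2$ which is equidimensional, i.e. $\dim(A/\mathfrak p)=d$ for every minimal prime $\mathfrak p$ of $A$. For $1\le t\le d-1$ let $\Gamma_t(A)$ be the graph whose vertices are the minimal primes of $A$, with an edge between distinct vertices $\mathfrak p,\mathfrak q$ if and only if $\operatorname{ht}_A(\mathfrak p+\mathfrak q)\le t$. Let $c(A)$ be the connectedness dimension of $A$, i.e. the minimum of $\dim X$ over all closed subsets $X\subseteq\operatorname{Spec}(A)$ for which $\operatorname{Spec}(A)\setminus X$ is disconnected, where the empty set is considered disconnected. Write $\#$ for the number of connected components of a graph or of a topological space. (1) For every $1\le t\le d-1$, the graph $\Gamma_t(A)$ is connected if and only if $c(A)\ge d-t$. Consequently, if $A$ has at least two minimal primes, then $$c(A)=\max\{\, i \;:\; 1\le i\le d-1,\ \Gamma_{d-i}(A)\text{ is connected}\,\},$$ where the maximum of the empty set is taken to be $0$; and if $A$ has exactly one minimal prime, then $c(A)=d$. (2) For every $1\le t\le d-1$, $$\#\Gamma_t(A)=\max\{\,\#(\operatorname{Spec}(A)\setminus X)\;:\; X\subseteq\operatorname{Spec}(A)\text{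 closed},\ \dim X\le d-t-1\,\}.$$ -/

import Mathlib

/-- A commutative ring `A` is equidimensional if `dim (A / p) = dim A` for every minimal prime `p`. -/
def IsEquidimensionalRing (A : Type*) [CommRing A] : Prop :=
  ∀ p ∈ minimalPrimes A, ringKrullDim (A ⧸ p) = ringKrullDim A

/-- The dimensions of the closed subsets `X` of `Spec A` for which `Spec A \ X` is disconnected.
The empty set counts as disconnected (`IsConnected` includes non-emptiness). -/
def disconnectingDims (A : Type*) [CommRing A] : Set (WithBot ℕ∞) :=
  {n | ∃ X : Set (PrimeSpectrum A), IsClosed X ∧ ¬ IsConnected Xᶜ ∧ n = topologicalKrullDim X}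

/-- The connectedness dimension `c(A)`: the minimal dimension of a closed subset of `Spec A` whose
complement is disconnected. -/
noncomputable def connectednessDim (A : Type*) [CommRing A] : WithBot ℕ∞ :=
  sInf (disconnectingDims A)

/-- The infimum in the definition of `c(A)` is always attained, i.e. it is a minimum. -/
theorem connectednessDim_isLeast (A : Type*) [CommRing A] :
    IsLeast (disconnectingDims A) (connectednessDim A) := by
  have hne : (disconnectingDims A).Nonempty :=
    ⟨_, Set.univ, isClosed_univ, by simp [IsConnected], rfl⟩
  exact ⟨csInf_mem hne, fun _ h => sInf_le h⟩

/-- The graph `Γ_t(A)`: its vertices are the minimal primes of `A`, and distinct vertices `p`, `q`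
are joined by an edge if and only if the height of the ideal `p + q` is at most `t`. -/
def minimalPrimesGraph (A : Type*) [CommRing A] (t : ℕ) : SimpleGraph (minimalPrimes A) where
  Adj p q := p ≠ q ∧ (p.1 + q.1).height ≤ (t : ℕ∞)
  symm := ⟨fun p q h => ⟨h.1.symm, by rw [add_comm]; exact h.2⟩⟩
  loopless := ⟨fun _ h => h.1 rfl⟩

/-! Everything rests on translating heights into dimensions. If `I` contains a minimal prime of `A`,
then `ht I ≤ t` is equivalent to `dim A/I ≥ d - t`. One direction holds in any ring; the other uses
equidimensionality and the dimension formula for complete local domains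
(`ringKrullDim_le_height_add_ringKrullDim_quotient`). So an edge of `Γ_t` says exactly that `V(p +
q)` is too large to lie in a closed set of dimension at most `d - t - 1`.

Given such a closed `X`, no minimal prime lies in `X`, adjacent minimal primes specialize to a
common point outside `X`, and every point outside `X` is a specialization of a minimal prime. Hence
components of `Γ_t` surject onto components of the complement of `X`. Conversely, let `X` be the
union of the `V(p + q)` with `p`, `q` in different components of `Γ_t`. It has dimension at most `d
- t - 1`, and off `X` the graph component of a minimal prime below a point is well defined and
locally constant, which gives a surjection the other way. Both assertions follow.

The dimension formula reduces by induction to a prime `P` of height one in a complete local domain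
`B`. There `B` is made finite over a normal complete domain `R`, a power series ring over a
coefficient ring, chosen so that `P` contains the image of a prime element `π` of `R`. Going down
forces `P` to lie over `(π)`, so `B/P` has dimension `dim R - 1 = dim B - 1`.

Coefficient rings come from formal smoothness over `ℚ` in residue characteristic zero. In residue
characteristic `p`, one lifts a `p`-basis of the residue field, forms at each level `n` the subring
of `B` generated modulo `𝔪 ^ (n + 1)` by the lifts and the `n`-th ghost components of Witt vectors,
and intersects over `n`. The elements of the intersection that lie in `𝔪` are its multiples of `p`,
so it is a field or a discrete valuation ring. -/

/-! ### Completeness -/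

theorem isPrecomplete_of_sub_mem {R : Type*} [CommRing R] {I : Ideal R}
    (h : ∀ f : ℕ → R, (∀ n, f (n + 1) - f n ∈ I ^ n) → ∃ L, ∀ n, L - f n ∈ I ^ n) :
    IsPrecomplete I R where
  prec' f hf := by
    obtain ⟨L, hL⟩ := h f fun n => by
      have := (hf (Nat.le_succ n)).symm
      rwa [SModEq.sub_mem, smul_eq_mul, Ideal.mul_top] at this
    refine ⟨L, fun n => ?_⟩
    rw [SModEq.comm, SModEq.sub_mem, smul_eq_mul, Ideal.mul_top]
    exact hL n

theorem IsPrecomplete.exists_sub_mem {R : Type*} [CommRing R] (I : Ideal R) [IsPrecomplete I R]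
    (f : ℕ → R) (hf : ∀ n, f (n + 1) - f n ∈ I ^ n) : ∃ L, ∀ n, L - f n ∈ I ^ n := by
  obtain ⟨L, hL⟩ := IsPrecomplete.prec' (I := I) (M := R) f (fun {m n} hmn => by
    rw [SModEq.comm, SModEq.sub_mem, smul_eq_mul, Ideal.mul_top]
    induction n, hmn using Nat.le_induction with
    | base => simp
    | succ n hmn ih =>
      have := add_mem (Ideal.pow_le_pow_right hmn (hf n)) ih
      simpa using this)
  refine ⟨L, fun n => ?_⟩
  have := (hL n).symm
  rwa [SModEq.sub_mem, smul_eq_mul, Ideal.mul_top] at this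

theorem IsLocalRing.map_mk_maximalIdeal {A : Type*} [CommRing A] [IsLocalRing A] (I : Ideal A)
    [IsLocalRing (A ⧸ I)] :
    (maximalIdeal A).map (Ideal.Quotient.mk I) = maximalIdeal (A ⧸ I) := by
  have : IsLocalHom (Ideal.Quotient.mk I) :=
    .of_surjective _ Ideal.Quotient.mk_surjective
  have h := ((local_hom_TFAE (Ideal.Quotient.mk I)).out 0 4).mp this
  rw [← h, Ideal.map_comap_of_surjective _ Ideal.Quotient.mk_surjective]

theorem IsLocalRing.isHausdorff_maximalIdeal (A : Type*) [CommRing A] [IsLocalRing A]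
    [IsNoetherianRing A] : IsHausdorff (maximalIdeal A) A where
  haus' x hx := by
    have h := Ideal.iInf_pow_eq_bot_of_isLocalRing (maximalIdeal A) (Ideal.IsPrime.ne_top')
    rw [← Ideal.mem_bot, ← h, Ideal.mem_iInf]
    intro n
    have := hx n
    rwa [SModEq.sub_mem, smul_eq_mul, Ideal.mul_top, sub_zero] at this

/-- A quotient of a complete Noetherian local ring is complete. -/
theorem IsLocalRing.isAdicComplete_quotient {A : Type*} [CommRing A] [IsLocalRing A]
    [IsNoetherianRing A] [IsAdicComplete (maximalIdeal A) A] (I : Ideal A)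
    [IsLocalRing (A ⧸ I)] : IsAdicComplete (maximalIdeal (A ⧸ I)) (A ⧸ I) where
  toIsHausdorff := isHausdorff_maximalIdeal _
  toIsPrecomplete := by
    refine isPrecomplete_of_sub_mem fun f hf => ?_
    simp only [← map_mk_maximalIdeal I, ← Ideal.map_pow] at hf ⊢
    have key : ∀ n, ∃ a ∈ maximalIdeal A ^ n, Ideal.Quotient.mk I a = f (n + 1) - f n := fun n =>
      (Ideal.mem_map_iff_of_surjective _ Ideal.Quotient.mk_surjective).mp (hf n)
    choose a ha ha' using key
    obtain ⟨b, hb⟩ := Ideal.Quotient.mk_surjective (f 0)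
    obtain ⟨L, hL⟩ := IsPrecomplete.exists_sub_mem (maximalIdeal A)
      (fun n => b + ∑ i ∈ Finset.range n, a i) (fun n => by simpa [Finset.sum_range_succ] using ha n)
    refine ⟨Ideal.Quotient.mk I L, fun n => ?_⟩
    have : f n = Ideal.Quotient.mk I (b + ∑ i ∈ Finset.range n, a i) := by
      rw [map_add, map_sum, hb, Finset.sum_congr rfl fun i _ => ha' i, Finset.sum_range_sub]
      ring
    rw [this, ← map_sub]
    exact Ideal.mem_map_of_mem _ (hL n)

/-! ### Power series over a local ring -/

namespace PowerSeries

variable {S : Type*} [CommRing S]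

instance isLocalRing [IsLocalRing S] : IsLocalRing (PowerSeries S) :=
  inferInstanceAs (IsLocalRing (MvPowerSeries Unit S))

theorem mem_maximalIdeal_iff [IsLocalRing S] {f : PowerSeries S} :
    f ∈ IsLocalRing.maximalIdeal (PowerSeries S) ↔
      constantCoeff f ∈ IsLocalRing.maximalIdeal S := by
  simp [IsLocalRing.mem_maximalIdeal, mem_nonunits_iff, isUnit_iff_constantCoeff]

theorem X_mem_maximalIdeal [IsLocalRing S] :
    (X : PowerSeries S) ∈ IsLocalRing.maximalIdeal (PowerSeries S) := by
  rw [mem_maximalIdeal_iff, constantCoeff_X]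
  exact zero_mem _

theorem maximalIdeal_eq_sup [IsLocalRing S] :
    IsLocalRing.maximalIdeal (PowerSeries S) =
      (IsLocalRing.maximalIdeal S).map (C (R := S)) ⊔ Ideal.span {X} := by
  apply le_antisymm
  · intro f hf
    rw [mem_maximalIdeal_iff] at hf
    have : f = C (constantCoeff f) + (f - C (constantCoeff f)) := by ring
    rw [this]
    refine Submodule.add_mem_sup (Ideal.mem_map_of_mem _ hf) ?_
    rw [Ideal.mem_span_singleton, X_dvd_iff]
    simp
  · rw [sup_le_iff, Ideal.map_le_iff_le_comap, Ideal.span_singleton_le_iff_mem]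
    exact ⟨fun s hs => by rw [Ideal.mem_comap, mem_maximalIdeal_iff]; simpa using hs,
      X_mem_maximalIdeal⟩

/-- A factor from the maximal ideal contributes either a constant coefficient in the maximal ideal
of `S` or a positive power of `X`. With the converse below, convergence of power series can be
tested coefficientwise. -/
theorem coeff_mem_pow_of_mem_pow [IsLocalRing S] (n : ℕ) {f : PowerSeries S}
    (hf : f ∈ IsLocalRing.maximalIdeal (PowerSeries S) ^ n) (j : ℕ) :
    coeff j f ∈ IsLocalRing.maximalIdeal S ^ (n - j) := by
  induction n generalizing f j with
  | zero => simp
  | succ n ih =>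
    rw [pow_succ] at hf
    refine Submodule.mul_induction_on hf (fun g hg h hh => ?_) (fun g h hg hh => ?_)
    · rw [coeff_mul]
      refine sum_mem fun x hx => ?_
      have hx' : x.1 + x.2 = j := by simpa using hx
      have h1 := ih hg x.1
      rcases Nat.eq_zero_or_pos x.2 with h0 | h0
      · have h2 : coeff x.2 h ∈ IsLocalRing.maximalIdeal S := by
          rw [h0]; simpa using mem_maximalIdeal_iff.mp hh
        have := Ideal.mul_mem_mul h1 h2
        rw [← pow_succ] at this
        exact Ideal.pow_le_pow_right (by omega) this
      · exact Ideal.mul_mem_right _ _ (Ideal.pow_le_pow_right (by omega) h1)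
    · rw [map_add]
      exact add_mem hg hh

theorem mem_pow_of_coeff_mem_pow [IsLocalRing S] (n : ℕ) {f : PowerSeries S}
    (hf : ∀ j, coeff j f ∈ IsLocalRing.maximalIdeal S ^ (n - j)) :
    f ∈ IsLocalRing.maximalIdeal (PowerSeries S) ^ n := by
  have hC : (IsLocalRing.maximalIdeal S).map (C (R := S)) ≤
      IsLocalRing.maximalIdeal (PowerSeries S) := by
    rw [maximalIdeal_eq_sup]; exact le_sup_left
  have h1 : f = (f - ∑ j ∈ Finset.range n, C (coeff j f) * X ^ j) +
      ∑ j ∈ Finset.range n, C (coeff j f) * X ^ j := by ring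
  rw [h1]
  refine add_mem ?_ (sum_mem fun j hj => ?_)
  · have : (X : PowerSeries S) ^ n ∣ f - ∑ j ∈ Finset.range n, C (coeff j f) * X ^ j := by
      rw [X_pow_dvd_iff]
      intro m hm
      simp [coeff_C_mul, coeff_X_pow, hm]
    exact Ideal.mem_of_dvd _ this (Ideal.pow_mem_pow X_mem_maximalIdeal n)
  · have h2 : C (coeff j f) ∈ IsLocalRing.maximalIdeal (PowerSeries S) ^ (n - j) := by
      refine Ideal.pow_right_mono hC _ ?_
      rw [← Ideal.map_pow]
      exact Ideal.mem_map_of_mem _ (hf j)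
    have h3 := Ideal.mul_mem_mul h2 (Ideal.pow_mem_pow X_mem_maximalIdeal j)
    rw [← pow_add] at h3
    rw [Finset.mem_range] at hj
    rwa [Nat.sub_add_cancel hj.le] at h3

/-- Power series over a complete local ring form a complete local ring. -/
theorem isPrecomplete_maximalIdeal [IsLocalRing S] [IsPrecomplete (IsLocalRing.maximalIdeal S) S] :
    IsPrecomplete (IsLocalRing.maximalIdeal (PowerSeries S)) (PowerSeries S) := by
  refine isPrecomplete_of_sub_mem fun f hf => ?_
  have key : ∀ j, ∃ L, ∀ n, L - coeff j (f (n + j)) ∈ IsLocalRing.maximalIdeal S ^ n := fun j => by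
    refine IsPrecomplete.exists_sub_mem _ _ fun n => ?_
    have := coeff_mem_pow_of_mem_pow _ (hf (n + j)) j
    rwa [map_sub, Nat.add_sub_cancel, show n + j + 1 = n + 1 + j by omega] at this
  choose L hL using key
  refine ⟨mk L, fun n => mem_pow_of_coeff_mem_pow n fun j => ?_⟩
  rcases le_total j n with h | h
  · have := hL j (n - j)
    rw [Nat.sub_add_cancel h] at this
    simpa using this
  · simp [Nat.sub_eq_zero_of_le h]

/-- Evaluation of power series at an element of the maximal ideal of a complete local ring. -/
theorem exists_ringHom_eval {B : Type*} [CommRing B] [IsLocalRing B]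
    [IsAdicComplete (IsLocalRing.maximalIdeal B) B] (f : S →+* B) {x : B}
    (hx : x ∈ IsLocalRing.maximalIdeal B) :
    ∃ F : PowerSeries S →+* B, F X = x ∧ ∀ s, F (C s) = f s := by
  let : WithIdeal B := ⟨IsLocalRing.maximalIdeal B⟩
  let : UniformSpace S := ⊥
  have : DiscreteTopology S := ⟨rfl⟩
  have hc := (IsAdic.isAdicComplete_iff (I := IsLocalRing.maximalIdeal B) rfl).mp inferInstance
  have := hc.1
  have := hc.2
  have hf : Continuous f := continuous_of_discreteTopology
  have hx' : HasEval x := by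
    rw [hasEval_def, IsTopologicallyNilpotent]
    refine ((Ideal.hasBasis_nhds_zero_adic (IsLocalRing.maximalIdeal B)).tendsto_right_iff).mpr ?_
    intro i _
    filter_upwards [Filter.eventually_ge_atTop i] with n hn
    exact Ideal.pow_le_pow_right hn (Ideal.pow_mem_pow hx n)
  refine ⟨eval₂Hom hf hx', ?_, fun s => ?_⟩
  · rw [coe_eval₂Hom, eval₂_X]
  · rw [coe_eval₂Hom, eval₂_C]

theorem ringKrullDim_eq_add_one [IsNoetherianRing S] [IsLocalRing S] :
    ringKrullDim (PowerSeries S) = ringKrullDim S + 1 := by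
  rw [← ringKrullDim_quotient_span_singleton_succ_eq_ringKrullDim_of_mem_nonZeroDivisors
    (x := (X : PowerSeries S)) MvPowerSeries.X_mem_nonzeroDivisors X_mem_maximalIdeal]
  have hker : RingHom.ker (constantCoeff (R := S)) = Ideal.span {X} := by
    ext f
    rw [RingHom.mem_ker, Ideal.mem_span_singleton, X_dvd_iff]
  rw [← hker, ringKrullDim_eq_of_ringEquiv
    (RingHom.quotientKerEquivOfSurjective (constantCoeff_surj (R := S)))]

theorem prime_C [IsDomain S] {π : S} (hπ : Prime π) : Prime (C π : PowerSeries S) := by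
  have hI : (Ideal.span {π}).IsPrime := (Ideal.span_singleton_prime hπ.ne_zero).mpr hπ
  have hker : RingHom.ker (map (Ideal.Quotient.mk (Ideal.span {π}))) =
      Ideal.span {(C π : PowerSeries S)} := by
    ext f
    rw [RingHom.mem_ker, Ideal.mem_span_singleton]
    constructor
    · intro h
      have h1 : ∀ n, ∃ c, coeff n f = π * c := fun n => by
        have := congrArg (coeff n) h
        rw [coeff_map, map_zero, Ideal.Quotient.eq_zero_iff_mem, Ideal.mem_span_singleton] at this
        exact this
      choose c hc using h1
      exact ⟨mk c, by ext n; simp [hc]⟩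
    · rintro ⟨g, rfl⟩
      have : Ideal.Quotient.mk (Ideal.span {π}) π = 0 :=
        Ideal.Quotient.eq_zero_iff_mem.mpr (Ideal.mem_span_singleton_self π)
      simp [this]
  have hC : (C π : PowerSeries S) ≠ 0 := fun h => hπ.ne_zero <| by
    simpa using congrArg constantCoeff h
  rw [← Ideal.span_singleton_prime hC, ← hker]
  exact RingHom.ker_isPrime _

end PowerSeries

/-! ### Normality -/

/-- Complete integral closedness, phrased in terms of divisibility. -/
theorem isIntegrallyClosed_iff_forall_dvd {R : Type*} [CommRing R] [IsDomain R]
    [IsNoetherianRing R] :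
    IsIntegrallyClosed R ↔ ∀ a b c : R, b ≠ 0 → c ≠ 0 → (∀ n, b ^ n ∣ c * a ^ n) → b ∣ a := by
  have hinj := IsFractionRing.injective R (FractionRing R)
  rw [isIntegrallyClosed_iff (FractionRing R)]
  constructor
  · intro h a b c hb hc hdvd
    have hb' : algebraMap R (FractionRing R) b ≠ 0 := by
      rwa [Ne, FaithfulSMul.algebraMap_eq_zero_iff]
    -- `c` is a common denominator for all powers of `a / b`; over a Noetherian ring this already
    -- implies integrality.
    have : IsAlmostIntegral R (algebraMap R (FractionRing R) a / algebraMap R _ b) := by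
      refine ⟨c, mem_nonZeroDivisors_of_ne_zero hc, fun n => ?_⟩
      obtain ⟨e, he⟩ := hdvd n
      refine ⟨e, ?_⟩
      rw [Algebra.smul_def, div_pow, mul_div_assoc', eq_div_iff (pow_ne_zero _ hb'), mul_comm,
        ← map_pow, ← map_pow, ← map_mul, ← map_mul, he]
    obtain ⟨y, hy⟩ := h this.isIntegral
    refine ⟨y, hinj ?_⟩
    rw [map_mul, hy, mul_div_cancel₀ _ hb']
  · intro h x hx
    obtain ⟨a, ⟨b, hb⟩, rfl⟩ := IsLocalization.exists_mk'_eq (nonZeroDivisors R) x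
    obtain ⟨c, hc, hcx⟩ := hx.isAlmostIntegral
    have hb' : algebraMap R (FractionRing R) b ≠ 0 := by
      rw [Ne, FaithfulSMul.algebraMap_eq_zero_iff]
      exact nonZeroDivisors.ne_zero hb
    obtain ⟨y, hy⟩ := h a b c (nonZeroDivisors.ne_zero hb) (nonZeroDivisors.ne_zero hc) fun n => by
      obtain ⟨e, he⟩ := hcx n
      refine ⟨e, hinj ?_⟩
      rw [IsFractionRing.mk'_eq_div, Algebra.smul_def, div_pow, mul_div_assoc',
        eq_div_iff (pow_ne_zero _ hb')] at he
      rw [map_mul, map_mul, map_pow, map_pow, ← he, mul_comm]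
    refine ⟨y, ?_⟩
    rw [IsFractionRing.mk'_eq_div, eq_div_iff hb', hy, map_mul, mul_comm]

theorem Prime.dvd_of_dvd_pow_mul {R : Type*} [CommRing R] [IsDomain R] {x : R} (hx : Prime x)
    {b y : R} (hb : ¬ x ∣ b) (n : ℕ) (h : b ∣ x ^ n * y) : b ∣ y := by
  induction n with
  | zero => simpa using h
  | succ n ih =>
    apply ih
    obtain ⟨z, hz⟩ := h
    have : x ∣ b * z := ⟨x ^ n * y, by rw [← hz]; ring⟩
    obtain ⟨w, rfl⟩ := (hx.dvd_or_dvd this).resolve_left hb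
    refine ⟨w, mul_left_cancel₀ hx.ne_zero ?_⟩
    linear_combination hz

/-- A Noetherian local domain is normal if its quotient by a prime element is. -/
theorem IsIntegrallyClosed.of_quotient_prime {R : Type*} [CommRing R] [IsDomain R]
    [IsNoetherianRing R] [IsLocalRing R] {x : R} (hx : Prime x)
    [IsIntegrallyClosed (R ⧸ Ideal.span {x})] : IsIntegrallyClosed R := by
  have hI : (Ideal.span {x}).IsPrime := (Ideal.span_singleton_prime hx.ne_zero).mpr hx
  have hmk : ∀ y, Ideal.Quotient.mk (Ideal.span {x}) y = 0 ↔ x ∣ y := fun y => by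
    rw [Ideal.Quotient.eq_zero_iff_mem, Ideal.mem_span_singleton]
  have hquot := isIntegrallyClosed_iff_forall_dvd.mp ‹IsIntegrallyClosed (R ⧸ Ideal.span {x})›
  rw [isIntegrallyClosed_iff_forall_dvd]
  -- the case where `x` divides neither `b` nor `c`
  have step : ∀ a b c : R, ¬ x ∣ b → ¬ x ∣ c → (∀ n, b ^ n ∣ c * a ^ n) →
      ∃ r a', a = b * r + x * a' ∧ ∀ n, b ^ n ∣ c * a' ^ n := by
    intro a b c hb hc h
    obtain ⟨r, hr⟩ := hquot (Ideal.Quotient.mk _ a) (Ideal.Quotient.mk _ b) (Ideal.Quotient.mk _ c)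
      (by rwa [Ne, hmk]) (by rwa [Ne, hmk]) (fun n => by
        simpa using map_dvd (Ideal.Quotient.mk (Ideal.span {x})) (h n))
    obtain ⟨r, rfl⟩ := Ideal.Quotient.mk_surjective r
    rw [← map_mul, ← sub_eq_zero, ← map_sub, hmk] at hr
    obtain ⟨a', ha'⟩ := hr
    refine ⟨r, a', by linear_combination ha', fun n => ?_⟩
    -- In the `i`-th binomial term, `c * a ^ i` supplies `b ^ i` and `(b * r) ^ (n - i)` supplies
    -- the remaining factors of `b`.
    have h1 : b ^ n ∣ c * (a + -(b * r)) ^ n := by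
      rw [add_pow, Finset.mul_sum]
      refine Finset.dvd_sum fun i hi => ?_
      rw [Finset.mem_range] at hi
      obtain ⟨e, he⟩ := h i
      refine ⟨e * (-r) ^ (n - i) * (n.choose i), ?_⟩
      calc c * (a ^ i * (-(b * r)) ^ (n - i) * (n.choose i))
          = (c * a ^ i) * (b * -r) ^ (n - i) * (n.choose i) := by ring
        _ = b ^ (i + (n - i)) * (e * (-r) ^ (n - i) * (n.choose i)) := by
          rw [he, mul_pow, pow_add]; ring
        _ = _ := by rw [Nat.add_sub_cancel' (by omega)]
    rw [← sub_eq_add_neg, ha', mul_pow, mul_left_comm] at h1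
    exact hx.dvd_of_dvd_pow_mul (fun h2 => hb (hx.dvd_of_dvd_pow h2)) n h1
  have main : ∀ a b c : R, ¬ x ∣ b → ¬ x ∣ c → (∀ n, b ^ n ∣ c * a ^ n) → b ∣ a := by
    intro a b c hb hc h
    -- Iteration puts `a` in `(b) + (x ^ k)` for every `k`; Krull's intersection theorem in `R /
    -- (b)` then puts it in `(b)`.
    have approx : ∀ k, ∃ r a', a = b * r + x ^ k * a' ∧ ∀ n, b ^ n ∣ c * a' ^ n := by
      intro k
      induction k with
      | zero => exact ⟨0, a, by simp, h⟩
      | succ k ih =>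
        obtain ⟨r, a', rfl, ha'⟩ := ih
        obtain ⟨r', a'', rfl, ha''⟩ := step a' b c hb hc ha'
        exact ⟨r + x ^ k * r', a'', by ring, ha''⟩
    by_cases hbu : IsUnit b
    · exact hbu.dvd
    have : Nontrivial (R ⧸ Ideal.span {b}) :=
      Ideal.Quotient.nontrivial_iff.mpr (by rwa [Ne, Ideal.span_singleton_eq_top])
    have : IsLocalRing (R ⧸ Ideal.span {b}) := .of_surjective' _ Ideal.Quotient.mk_surjective
    have hxm : Ideal.Quotient.mk (Ideal.span {b}) x ∈
        IsLocalRing.maximalIdeal (R ⧸ Ideal.span {b}) := by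
      rw [← IsLocalRing.map_mk_maximalIdeal]
      exact Ideal.mem_map_of_mem _ hx.not_isUnit
    have h0 : Ideal.Quotient.mk (Ideal.span {b}) a = 0 := by
      rw [← Ideal.mem_bot, ← Ideal.iInf_pow_eq_bot_of_isLocalRing
        (IsLocalRing.maximalIdeal (R ⧸ Ideal.span {b})) Ideal.IsPrime.ne_top', Ideal.mem_iInf]
      intro k
      obtain ⟨r, a', hk, -⟩ := approx k
      have hb0 : Ideal.Quotient.mk (Ideal.span {b}) b = 0 :=
        Ideal.Quotient.eq_zero_iff_mem.mpr (Ideal.mem_span_singleton_self b)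
      rw [hk, map_add, map_mul, hb0, zero_mul, zero_add, map_mul, map_pow]
      exact Ideal.mul_mem_right _ _ (Ideal.pow_mem_pow hxm k)
    rwa [Ideal.Quotient.eq_zero_iff_mem, Ideal.mem_span_singleton] at h0
  have main' : ∀ (β γ : ℕ) (a b c : R), ¬ x ∣ b → ¬ x ∣ c →
      (∀ n, (x ^ β * b) ^ n ∣ x ^ γ * c * a ^ n) → x ^ β * b ∣ a := by
    intro β γ
    induction β with
    | zero =>
      intro a b c hb hc h
      have := main a b c hb hc fun n => by
        refine hx.dvd_of_dvd_pow_mul (fun h2 => hb (hx.dvd_of_dvd_pow h2)) γ ?_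
        simpa [mul_assoc] using h n
      simpa using this
    | succ β ih =>
      intro a b c hb hc h
      have hxa : x ∣ a := by
        -- The exponent `γ + 1` just exceeds the power of `x` in the denominator, so one factor of
        -- `x` is left over and must divide the power of `a`.
        refine hx.dvd_of_dvd_pow (n := γ + 1) ?_
        have h1 : x ^ γ * x ∣ x ^ γ * (c * a ^ (γ + 1)) := by
          rw [← pow_succ, ← mul_assoc]
          refine dvd_trans ?_ (h (γ + 1))
          exact pow_dvd_pow_of_dvd ⟨x ^ β * b, by ring⟩ _
        exact (hx.dvd_or_dvd
          ((mul_dvd_mul_iff_left (pow_ne_zero _ hx.ne_zero)).mp h1)).resolve_left hc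
      obtain ⟨a', rfl⟩ := hxa
      have := ih a' b c hb hc fun n => by
        have h2 := h n
        rw [show x ^ (β + 1) * b = x * (x ^ β * b) by ring, mul_pow, mul_pow x a',
          mul_left_comm] at h2
        exact (mul_dvd_mul_iff_left (pow_ne_zero n hx.ne_zero)).mp h2
      rw [pow_succ', mul_assoc]
      exact mul_dvd_mul_left x this
  intro a b c hb hc h
  obtain ⟨b', hbb', hb'⟩ :=
    (FiniteMultiplicity.of_not_isUnit hx.not_isUnit hb).exists_eq_pow_mul_and_not_dvd
  obtain ⟨c', hcc', hc'⟩ :=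
    (FiniteMultiplicity.of_not_isUnit hx.not_isUnit hc).exists_eq_pow_mul_and_not_dvd
  rw [hbb'] at h ⊢
  rw [hcc'] at h
  exact main' _ _ a b' c' hb' hc' h

theorem PowerSeries.isIntegrallyClosed {S : Type*} [CommRing S] [IsDomain S] [IsNoetherianRing S]
    [IsLocalRing S] [IsIntegrallyClosed S] : IsIntegrallyClosed (PowerSeries S) := by
  have hker : RingHom.ker (constantCoeff (R := S)) = Ideal.span {X} := by
    ext f
    rw [RingHom.mem_ker, Ideal.mem_span_singleton, X_dvd_iff]
  have e : S ≃+* PowerSeries S ⧸ Ideal.span {(X : PowerSeries S)} :=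
    (RingHom.quotientKerEquivOfSurjective (constantCoeff_surj (R := S))).symm.trans
      (Ideal.quotEquivOfEq hker)
  have := IsIntegrallyClosed.of_equiv e
  exact .of_quotient_prime (x := X) X_prime

/-! ### Integral extensions -/

theorem Algebra.IsIntegral.ringKrullDim_le {R S : Type*} [CommRing R] [CommRing S] [Algebra R S]
    [Algebra.IsIntegral R S] : ringKrullDim S ≤ ringKrullDim R := by
  refine Order.krullDim_le_of_strictMono (PrimeSpectrum.comap (algebraMap R S)) fun P Q h => ?_
  exact Ideal.IsIntegral.comap_lt_comap (I := P.asIdeal) (J := Q.asIdeal) h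

theorem Algebra.IsIntegral.ringKrullDim_eq {R S : Type*} [CommRing R] [CommRing S] [Algebra R S]
    [FaithfulSMul R S] [Algebra.IsIntegral R S] : ringKrullDim S = ringKrullDim R := by
  refine le_antisymm ringKrullDim_le ?_
  refine iSup_le fun l => ?_
  obtain ⟨P, -, hP, hP'⟩ := Ideal.exists_ideal_over_prime_of_isIntegral (S := S) l.head.asIdeal ⊥ (by
    rw [← RingHom.ker_eq_comap_bot, (RingHom.injective_iff_ker_eq_bot _).mp
      (FaithfulSMul.algebraMap_injective R S)]
    exact bot_le)
  have : P.LiesOver l.head.asIdeal := ⟨hP'.symm⟩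
  obtain ⟨L, hL, -, -⟩ := Ideal.exists_ltSeries_of_hasGoingUp l P
  rw [← hL]
  exact le_iSup (fun L : LTSeries (PrimeSpectrum S) => (L.length : WithBot ℕ∞)) L

/-- A height one prime of a finite extension `B` of a normal domain `R`, containing a prime
element of `R`, has the expected dimension. -/
theorem ringKrullDim_le_quotient_add_one_of_prime_mem {R B : Type*} [CommRing R] [IsDomain R]
    [IsNoetherianRing R] [IsLocalRing R] [IsIntegrallyClosed R] [CommRing B] [IsDomain B]
    [Algebra R B] [FaithfulSMul R B] [Algebra.IsIntegral R B] {P : Ideal B} [P.IsPrime]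
    (hP : P.height ≤ 1) {π : R} (hπ : Prime π) (hπP : algebraMap R B π ∈ P) :
    ringKrullDim B ≤ ringKrullDim (B ⧸ P) + 1 := by
  have hI : (Ideal.span {π}).IsPrime := (Ideal.span_singleton_prime hπ.ne_zero).mpr hπ
  have hle : Ideal.span {π} ≤ P.under R := by
    rw [Ideal.span_singleton_le_iff_mem]; exact hπP
  -- Going down, the reason for demanding that `R` be normal. Since `Q` is nonzero inside a prime of
  -- height at most one, it equals `P`.
  obtain ⟨Q, hQP, hQ, hQπ⟩ := Ideal.exists_ideal_le_liesOver_of_le (p := Ideal.span {π}) P hle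
  have hQ0 : Q ≠ ⊥ := by
    rintro rfl
    have h1 : π ∈ (⊥ : Ideal B).under R := by
      rw [← hQπ.over]; exact Ideal.mem_span_singleton_self π
    rw [Ideal.mem_under, Ideal.mem_bot, FaithfulSMul.algebraMap_eq_zero_iff] at h1
    exact hπ.ne_zero h1
  have hQP' : Q = P := by
    by_contra hne
    have h1 := Ideal.height_add_one_le_of_lt_of_isPrime (lt_of_le_of_ne hQP hne)
    have h2 : Q.height = 0 := by
      have := h1.trans hP
      have h3 : Q.height + 1 ≤ 0 + 1 := by simpa using this
      simpa using (ENat.add_le_add_iff_right ENat.one_ne_top).mp h3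
    exact hQ0 (Ideal.height_eq_zero_iff_eq_bot.mp h2)
  subst hQP'
  have h1 : ringKrullDim (B ⧸ Q) = ringKrullDim (R ⧸ Ideal.span {π}) := 
    Algebra.IsIntegral.ringKrullDim_eq
  rw [h1, Algebra.IsIntegral.ringKrullDim_eq (R := R) (S := B)]
  exact (ringKrullDim_quotient_span_singleton_succ_eq_ringKrullDim_of_mem_nonZeroDivisors
    (mem_nonZeroDivisors_of_ne_zero hπ.ne_zero) hπ.not_isUnit).ge

/-! ### Finiteness over a complete local ring -/

theorem IsPrecomplete.of_finite {R : Type*} [CommRing R] (I : Ideal R) [IsPrecomplete I R]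
    (M : Type*) [AddCommGroup M] [Module R M] [Module.Finite R M] : IsPrecomplete I M := by
  rw [← AdicCompletion.of_surjective_iff]
  intro y
  obtain ⟨z, rfl⟩ := AdicCompletion.ofTensorProduct_surjective_of_finite I M y
  induction z with
  | zero => exact ⟨0, by simp⟩
  | add z w hz hw =>
    obtain ⟨a, ha⟩ := hz
    obtain ⟨b, hb⟩ := hw
    exact ⟨a + b, by rw [map_add, map_add, ha, hb]⟩
  | tmul r m =>
    obtain ⟨s, rfl⟩ := AdicCompletion.of_surjective I R r
    refine ⟨s • m, ?_⟩
    ext n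
    simp
    rfl

/-- A Noetherian local ring `B` is finite over a complete local ring `R` with the same residue
field if the maximal ideal of `R` generates an ideal of definition of `B`. -/
theorem IsLocalRing.moduleFinite_of_residue_surjective {R B : Type*} [CommRing R] [IsLocalRing R]
    [IsPrecomplete (maximalIdeal R) R] [CommRing B] [IsLocalRing B] [IsNoetherianRing B]
    [Algebra R B] (hres : ∀ b : B, ∃ r : R, b - algebraMap R B r ∈ maximalIdeal B)
    (hle : (maximalIdeal R).map (algebraMap R B) ≤ maximalIdeal B) {k : ℕ}
    (hk : maximalIdeal B ^ k ≤ (maximalIdeal R).map (algebraMap R B)) : Module.Finite R B := by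
  -- Passing from `i` to `i + 1` adjoins finitely many generators of `𝔪 ^ i`; their coefficients
  -- matter only modulo `𝔪`, hence may be taken from `R`.
  have key : ∀ i, ∃ N : Submodule R B, N.FG ∧ ∀ b : B, ∃ y ∈ N, b - y ∈ maximalIdeal B ^ i := by
    intro i
    induction i with
    | zero => exact ⟨⊥, Submodule.fg_bot, fun b => ⟨0, zero_mem _, by simp⟩⟩
    | succ i ih =>
      obtain ⟨N, hN, hN'⟩ := ih
      obtain ⟨T, hT⟩ := IsNoetherian.noetherian (maximalIdeal B ^ i)
      have hz : ∀ z ∈ Submodule.span B (T : Set B),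
          ∃ y ∈ Submodule.span R (T : Set B), z - y ∈ maximalIdeal B ^ (i + 1) := by
        intro z hz
        induction hz using Submodule.span_induction with
        | mem x hx => exact ⟨x, Submodule.subset_span hx, by simp⟩
        | zero => exact ⟨0, zero_mem _, by simp⟩
        | add x y _ _ hx hy =>
          obtain ⟨a, ha, ha'⟩ := hx
          obtain ⟨b, hb, hb'⟩ := hy
          exact ⟨a + b, add_mem ha hb, by simpa [add_sub_add_comm] using add_mem ha' hb'⟩
        | smul b x hxT hx =>
          obtain ⟨a, ha, ha'⟩ := hx
          obtain ⟨r, hr⟩ := hres b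
          refine ⟨r • a, Submodule.smul_mem _ _ ha, ?_⟩
          have h1 : b • x - r • a = (b - algebraMap R B r) * x + algebraMap R B r * (x - a) := by
            rw [smul_eq_mul, Algebra.smul_def]; ring
          rw [h1]
          refine add_mem ?_ (Ideal.mul_mem_left _ _ ha')
          rw [pow_succ']
          exact Ideal.mul_mem_mul hr (hT ▸ hxT)
      refine ⟨N ⊔ Submodule.span R T, hN.sup (Submodule.fg_span T.finite_toSet), fun b => ?_⟩
      obtain ⟨y, hy, hby⟩ := hN' b
      obtain ⟨w, hw, hbw⟩ := hz (b - y) (by rw [hT]; exact hby)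
      exact ⟨y + w, Submodule.add_mem_sup hy hw, by rwa [← sub_sub]⟩
  obtain ⟨N, hN, hN'⟩ := key k
  have : Module.Finite R N := Module.Finite.iff_fg.mpr hN
  have : IsPrecomplete (maximalIdeal R) N := .of_finite _ _
  have : IsHausdorff (maximalIdeal R) B := by
    rw [← IsHausdorff.map_algebraMap_iff (S := B)]
    have := isHausdorff_maximalIdeal B
    refine ⟨fun x hx => this.haus' x fun n => (hx n).mono ?_⟩
    exact Submodule.smul_mono_left (Ideal.pow_right_mono hle n)
  -- Complete Nakayama: `N` is precomplete, `B` is separated, and `N` fills `B` modulo the maximal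
  -- ideal of `R`.
  have hsurj : Function.Surjective N.subtype := by
    refine surjective_of_mkQ_comp_surjective (I := maximalIdeal R) fun y => ?_
    obtain ⟨b, rfl⟩ := Submodule.mkQ_surjective _ y
    obtain ⟨y, hy, hby⟩ := hN' b
    refine ⟨⟨y, hy⟩, ?_⟩
    rw [LinearMap.comp_apply, Submodule.subtype_apply, eq_comm, Submodule.mkQ_apply,
      Submodule.mkQ_apply, Submodule.Quotient.eq, Ideal.smul_top_eq_map]
    exact hk hby
  exact Module.Finite.of_surjective _ hsurj

open IsLocalRing
open scoped Pointwise

/-! ### Systems of parameters -/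

theorem IsLocalRing.exists_ringKrullDim_eq_natCast (B : Type*) [CommRing B] [IsLocalRing B]
    [IsNoetherianRing B] : ∃ n : ℕ, ringKrullDim B = n := by
  refine ⟨(maximalIdeal B).height.toNat, ?_⟩
  rw [← maximalIdeal_height_eq_ringKrullDim, ← WithBot.coe_natCast, ENat.natCast_toNat]
  exact Ideal.height_ne_top Ideal.IsPrime.ne_top'

theorem ringKrullDim_quotient_sup_succ_le {B : Type*} [CommRing B] (I : Ideal B) {a : B}
    (ha : ∀ p ∈ I.minimalPrimes, a ∉ p) :
    ringKrullDim (B ⧸ I ⊔ Ideal.span {a}) + 1 ≤ ringKrullDim (B ⧸ I) := by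
  have h1 := Module.supportDim_quotSMulTop_succ_le_of_notMem_minimalPrimes (R := B) (M := B ⧸ I)
    (x := a) (by rwa [Ideal.annihilator_quotient])
  rw [Module.supportDim_quotient_eq_ringKrullDim] at h1
  rw [← Module.supportDim_quotient_eq_ringKrullDim (I ⊔ Ideal.span {a})]
  refine le_trans ?_ h1
  gcongr
  have hle : a • (⊤ : Submodule B (B ⧸ I)) ≤
      LinearMap.ker (Submodule.factor (le_sup_left : I ≤ I ⊔ Ideal.span {a})) := by
    rintro _ ⟨x, -, rfl⟩
    obtain ⟨x, rfl⟩ := Submodule.Quotient.mk_surjective _ x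
    simp only [DistribSMul.toLinearMap_apply, LinearMap.mem_ker, map_smul]
    rw [← Submodule.mkQ_apply, Submodule.factor_mk, ← map_smul, Submodule.mkQ_apply,
      Submodule.Quotient.mk_eq_zero, smul_eq_mul]
    exact Ideal.mul_mem_right _ _ (Ideal.mem_sup_right (Ideal.mem_span_singleton_self a))
  refine Module.supportDim_le_of_surjective (Submodule.liftQ _ _ hle) ?_
  intro y
  obtain ⟨b, rfl⟩ := Submodule.Quotient.mk_surjective _ y
  exact ⟨Submodule.Quotient.mk (Submodule.Quotient.mk b), rfl⟩

/-- A system of parameters modulo an ideal. -/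
theorem IsLocalRing.exists_finset_pow_le_sup {B : Type*} [CommRing B] [IsLocalRing B]
    [IsNoetherianRing B] {I : Ideal B} (hI : I ≠ ⊤) :
    ∃ s : Finset B, (s : Set B) ⊆ maximalIdeal B ∧ (s.card : WithBot ℕ∞) = ringKrullDim (B ⧸ I) ∧
      ∃ k, maximalIdeal B ^ k ≤ I ⊔ Ideal.span s := by
  classical
  have : Nontrivial (B ⧸ I) := Ideal.Quotient.nontrivial_iff.mpr hI
  have : IsLocalRing (B ⧸ I) := .of_surjective' _ Ideal.Quotient.mk_surjective
  obtain ⟨s, hs, hcard⟩ := (maximalIdeal (B ⧸ I)).exists_finset_card_eq_height_of_isNoetherianRing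
  have hinv := Function.surjInv_eq (Ideal.Quotient.mk_surjective (I := I))
  set σ := Function.surjInv (Ideal.Quotient.mk_surjective (I := I)) with hσ
  have hσi : Function.Injective σ := Function.injective_surjInv _
  have hsm : (s : Set (B ⧸ I)) ⊆ maximalIdeal (B ⧸ I) := Ideal.span_le.mp hs.1.2
  have hloc : IsLocalHom (Ideal.Quotient.mk I) := .of_surjective _ Ideal.Quotient.mk_surjective
  refine ⟨s.image σ, ?_, ?_, ?_⟩
  · intro b hb
    simp only [Finset.coe_image, Set.mem_image] at hb
    obtain ⟨x, hx, rfl⟩ := hb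
    have h1 := hsm hx
    rw [← hinv x] at h1
    have h2 := ((local_hom_TFAE (Ideal.Quotient.mk I)).out 0 4).mp hloc
    rw [SetLike.mem_coe, ← h2]
    exact h1
  · rw [Finset.card_image_of_injective _ hσi, ← maximalIdeal_height_eq_ringKrullDim, ← hcard]
    rfl
  · refine Ideal.exists_pow_le_of_le_radical_of_fg ?_ (IsNoetherian.noetherian _)
    have hmap : (I ⊔ Ideal.span (s.image σ : Set B)).map (Ideal.Quotient.mk I) = Ideal.span s := by
      rw [Ideal.map_sup, Ideal.map_quotient_self, bot_sup_eq, Ideal.map_span, Finset.coe_image,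
        ← Set.image_comp]
      congr 1
      convert Set.image_id _
      exact funext hinv
    have hcomap : I ⊔ Ideal.span (s.image σ : Set B) =
        (Ideal.span (s : Set (B ⧸ I))).comap (Ideal.Quotient.mk I) := by
      rw [← hmap, Ideal.comap_map_of_surjective _ Ideal.Quotient.mk_surjective,
        ← RingHom.ker_eq_comap_bot, Ideal.mk_ker]
      exact (sup_eq_left.mpr le_sup_left).symm
    rw [hcomap, ← Ideal.comap_radical]
    have hrad : maximalIdeal (B ⧸ I) ≤ (Ideal.span (s : Set (B ⧸ I))).radical := by
      rw [Ideal.radical_eq_sInf]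
      refine le_sInf fun J hJ => ?_
      have := hJ.2
      exact hs.2 ⟨hJ.2, hJ.1⟩ (le_maximalIdeal this.ne_top)
    have h2 := ((local_hom_TFAE (Ideal.Quotient.mk I)).out 0 4).mp hloc
    rw [← h2]
    exact Ideal.comap_mono hrad

/-! ### Normal complete rings mapping to a complete local ring -/

/-- `R` is a complete normal Noetherian local domain of dimension `n`, and `f : R →+* B` is a
homomorphism to a local ring which induces a surjection on residue fields and is such that the
maximal ideal of `R` generates the ideal `J` of `B`. -/
structure IsNormalCover {R B : Type*} [CommRing R] [CommRing B] [IsLocalRing B] (f : R →+* B)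
    (J : Ideal B) (n : ℕ) : Prop where
  isDomain : IsDomain R
  isNoetherianRing : IsNoetherianRing R
  isLocalRing : IsLocalRing R
  isIntegrallyClosed : IsIntegrallyClosed R
  isPrecomplete : IsPrecomplete (maximalIdeal R) R
  ringKrullDim_eq : ringKrullDim R = n
  map_maximalIdeal : (maximalIdeal R).map f = J
  exists_sub_mem : ∀ b, ∃ r, b - f r ∈ maximalIdeal B

namespace IsNormalCover

theorem exists_adjoin {R B : Type*} [CommRing R] [CommRing B] [IsLocalRing B]
    [IsAdicComplete (maximalIdeal B) B] {f : R →+* B} {J : Ideal B} {n : ℕ}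
    (hf : IsNormalCover f J n) {x : B} (hx : x ∈ maximalIdeal B) :
    ∃ F : PowerSeries R →+* B, IsNormalCover F (J ⊔ Ideal.span {x}) (n + 1) ∧
      F PowerSeries.X = x ∧ ∀ s, F (PowerSeries.C s) = f s := by
  obtain ⟨F, hFX, hFC⟩ := PowerSeries.exists_ringHom_eval f hx
  have := hf.isDomain
  have := hf.isNoetherianRing
  have := hf.isLocalRing
  have := hf.isIntegrallyClosed
  have := hf.isPrecomplete
  refine ⟨F, ⟨inferInstance, inferInstance, inferInstance, PowerSeries.isIntegrallyClosed,
    PowerSeries.isPrecomplete_maximalIdeal, ?_, ?_, fun b => ?_⟩, hFX, hFC⟩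
  · rw [PowerSeries.ringKrullDim_eq_add_one, hf.ringKrullDim_eq]; rfl
  · have hcomp : F.comp (PowerSeries.C (R := R)) = f := RingHom.ext hFC
    rw [PowerSeries.maximalIdeal_eq_sup, Ideal.map_sup, Ideal.map_map, hcomp,
      hf.map_maximalIdeal, Ideal.map_span, Set.image_singleton, hFX]
  · obtain ⟨r, hr⟩ := hf.exists_sub_mem b
    exact ⟨PowerSeries.C r, by rwa [hFC]⟩

/-- Primes survive the enlargement because constants that are prime stay prime in power series. Thus
a prime element sent into `P` can be fixed first, and the remaining parameters adjoined afterwards.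
-/
theorem exists_adjoin_finset.{u} {R B : Type u} [CommRing R] [CommRing B] [IsLocalRing B]
    [IsAdicComplete (maximalIdeal B) B] {f : R →+* B} {J : Ideal B} {n : ℕ}
    (hf : IsNormalCover f J n) (s : Finset B) (hs : (s : Set B) ⊆ maximalIdeal B) :
    ∃ (R' : Type u) (_ : CommRing R') (F : R' →+* B) (g : R →+* R'),
      IsNormalCover F (J ⊔ Ideal.span s) (n + s.card) ∧ F.comp g = f ∧
      ∀ π, Prime π → Prime (g π) := by
  classical
  induction s using Finset.induction_on with
  | empty => exact ⟨R, _, f, RingHom.id R, by simpa using hf, rfl, fun _ h => h⟩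
  | insert x s hxs ih =>
    rw [Finset.coe_insert, Set.insert_subset_iff] at hs
    obtain ⟨R', _, F, g, hF, hFg, hg⟩ := ih hs.2
    obtain ⟨F', hF', -, hC⟩ := hF.exists_adjoin hs.1
    have := hF.isDomain
    refine ⟨PowerSeries R', inferInstance, F', (PowerSeries.C (R := R')).comp g, ?_, ?_,
      fun π hπ => PowerSeries.prime_C (hg π hπ)⟩
    · rw [Finset.card_insert_of_notMem hxs, ← add_assoc, Finset.coe_insert,
        Ideal.span_insert, sup_comm (Ideal.span {x}), ← sup_assoc]
      exact hF'
    · rw [← RingHom.comp_assoc, (RingHom.ext hC : F'.comp PowerSeries.C = F), hFg]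

theorem ringKrullDim_le {R B : Type*} [CommRing R] [CommRing B] [IsLocalRing B] [IsDomain B]
    [IsNoetherianRing B] {f : R →+* B} {J : Ideal B} {n : ℕ}
    (hf : IsNormalCover f J n) (hn : ringKrullDim B = n) (hJ : J ≤ maximalIdeal B) {k : ℕ}
    (hk : maximalIdeal B ^ k ≤ J) {P : Ideal B} [P.IsPrime] (hP : P.height ≤ 1) {π : R}
    (hπ : Prime π) (hπP : f π ∈ P) : ringKrullDim B ≤ ringKrullDim (B ⧸ P) + 1 := by
  have := hf.isDomain
  have := hf.isNoetherianRing
  have := hf.isLocalRing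
  have := hf.isIntegrallyClosed
  have := hf.isPrecomplete
  algebraize [f]
  have hfin : Module.Finite R B := by
    refine moduleFinite_of_residue_surjective (k := k) hf.exists_sub_mem ?_ ?_
    · rw [RingHom.algebraMap_toAlgebra, hf.map_maximalIdeal]; exact hJ
    · rw [RingHom.algebraMap_toAlgebra, hf.map_maximalIdeal]; exact hk
  have hint : Algebra.IsIntegral R B := inferInstance
  have hinj : Function.Injective f := by
    rw [injective_iff_map_eq_zero]
    intro a ha
    by_contra ha0
    -- Were `a ≠ 0` killed, `B` would be integral over `R / (a)`, whose dimension is less than `n =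
    -- dim B`.
    let g : R ⧸ Ideal.span {a} →+* B := Ideal.Quotient.lift _ f fun x hx => by
      obtain ⟨y, rfl⟩ := Ideal.mem_span_singleton.mp hx
      rw [map_mul, ha, zero_mul]
    have hg : g.comp (algebraMap R _) = f := RingHom.ext fun x => rfl
    algebraize [g]
    have : IsScalarTower R (R ⧸ Ideal.span {a}) B := .of_algebraMap_eq' hg.symm
    have : Algebra.IsIntegral (R ⧸ Ideal.span {a}) B := .tower_top R
    have h1 := Algebra.IsIntegral.ringKrullDim_le (R := R ⧸ Ideal.span {a}) (S := B)
    have h2 := ringKrullDim_quotient_succ_le_of_nonZeroDivisor (mem_nonZeroDivisors_of_ne_zero ha0)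
    have h3 := (add_le_add_left h1 1).trans h2
    rw [hn, hf.ringKrullDim_eq] at h3
    norm_cast at h3
    omega
  have : FaithfulSMul R B := (faithfulSMul_iff_algebraMap_injective R B).mpr hinj
  exact ringKrullDim_le_quotient_add_one_of_prime_mem hP hπ hπP

end IsNormalCover

/-! ### The dimension formula -/

/-- A coefficient ring of a complete local ring: either a field, or a complete discrete valuation
ring whose uniformizer does not map to zero. -/
def HasCoefficientRing.{u} (B : Type u) [CommRing B] [IsLocalRing B] : Prop :=
  ∃ (Λ : Type u) (_ : CommRing Λ) (f : Λ →+* B), IsNormalCover f ⊥ 0 ∨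
    ∃ ϖ : Λ, Prime ϖ ∧ f ϖ ≠ 0 ∧ f ϖ ∈ maximalIdeal B ∧ IsNormalCover f (Ideal.span {f ϖ}) 1

theorem HasCoefficientRing.ringKrullDim_le_of_height_eq_one.{u} {B : Type u} [CommRing B]
    [IsLocalRing B] [IsDomain B] [IsNoetherianRing B] [IsAdicComplete (maximalIdeal B) B]
    (hB : HasCoefficientRing B) {P : Ideal B} [hPp : P.IsPrime] (hP : P.height = 1) :
    ringKrullDim B ≤ ringKrullDim (B ⧸ P) + 1 := by
  obtain ⟨d, hd⟩ := exists_ringKrullDim_eq_natCast B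
  have hPm : P ≤ maximalIdeal B := le_maximalIdeal hPp.ne_top
  have hquot : ∀ x : B, x ≠ 0 → x ∈ maximalIdeal B →
      ringKrullDim (B ⧸ Ideal.span {x}) + 1 = d := fun x hx hxm => by
    rw [← hd]
    exact ringKrullDim_quotient_span_singleton_succ_eq_ringKrullDim_of_mem_nonZeroDivisors
      (mem_nonZeroDivisors_of_ne_zero hx) hxm
  have hne : ∀ J : Ideal B, J ≤ maximalIdeal B → J ≠ ⊤ := fun J hJ h =>
    (maximalIdeal.isMaximal B).ne_top (top_le_iff.mp (h ▸ hJ))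
  obtain ⟨Λ, _, f, hf | ⟨ϖ, hϖ, hϖ0, hϖm, hf⟩⟩ := hB
  -- Over a coefficient field, any nonzero `x ∈ P` extends to a system of parameters, and the
  -- variable sent to `x` is the required prime element.
  · obtain ⟨x, hxP, hx0⟩ := Submodule.exists_mem_ne_zero_of_ne_bot (Ideal.ne_bot_of_height_eq_one hP)
    have hxm := hPm hxP
    have hI : Ideal.span {x} ≤ maximalIdeal B := (Ideal.span_singleton_le_iff_mem _).mpr hxm
    obtain ⟨s, hs, hcard, k, hk⟩ := exists_finset_pow_le_sup (hne _ hI)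
    obtain ⟨F, hF, hFX, -⟩ := hf.exists_adjoin hxm
    obtain ⟨R, _, G, g, hG, hGg, hg⟩ := hF.exists_adjoin_finset s hs
    have := hf.isDomain
    rw [bot_sup_eq, zero_add] at hG
    refine hG.ringKrullDim_le ?_ (sup_le hI (Ideal.span_le.mpr hs)) hk hP.le
      (hg _ PowerSeries.X_prime) ?_
    · rw [hd, ← hquot x hx0 hxm, ← hcard, Nat.cast_add, add_comm]
      rfl
    · rw [← RingHom.comp_apply, hGg, hFX]
      exact hxP
  · have hI : Ideal.span {f ϖ} ≤ maximalIdeal B := (Ideal.span_singleton_le_iff_mem _).mpr hϖm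
    by_cases hϖP : f ϖ ∈ P
    -- Here the uniformizer itself lands in `P` and serves as the prime element.
    · obtain ⟨s, hs, hcard, k, hk⟩ := exists_finset_pow_le_sup (hne _ hI)
      obtain ⟨R, _, G, g, hG, hGg, hg⟩ := hf.exists_adjoin_finset s hs
      refine hG.ringKrullDim_le ?_ (sup_le hI (Ideal.span_le.mpr hs)) hk hP.le (hg _ hϖ) ?_
      · rw [hd, ← hquot _ hϖ0 hϖm, ← hcard, Nat.cast_add, add_comm]
        rfl
      · rw [← RingHom.comp_apply, hGg]
        exact hϖP
    -- Prime avoidance: otherwise `P` lies in a minimal prime of `(f ϖ)`, and comparing heights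
    -- gives equality, contradicting `f ϖ ∉ P`. Such an `x` forms with `f ϖ` part of a system of
    -- parameters.
    · obtain ⟨x, hxP, hx⟩ : ∃ x ∈ P, ∀ p ∈ (Ideal.span {f ϖ}).minimalPrimes, x ∉ p := by
        by_contra! h
        have hfin := Ideal.finite_minimalPrimes_of_isNoetherianRing B (Ideal.span {f ϖ})
        obtain ⟨q, hq, hPq⟩ := (P.subset_union_prime_finite hfin (f := id) 0 0
          fun q hq _ _ => hq.1.1).mp fun x hx => by
            obtain ⟨q, hq, hxq⟩ := h x hx
            exact Set.mem_biUnion hq hxq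
        have hqp : q.IsPrime := hq.1.1
        have hq1 : q.height ≤ 1 := Ideal.height_le_one_of_isPrincipal_of_mem_minimalPrimes _ _ hq
        have hqP : P = q := Ideal.eq_of_le_of_height_le (I := P) (J := q) hPq (by rwa [hP])
        exact hϖP (hqP ▸ hq.1.2 (Ideal.mem_span_singleton_self _))
      have hxm := hPm hxP
      have hI' : Ideal.span {f ϖ} ⊔ Ideal.span {x} ≤ maximalIdeal B :=
        sup_le hI ((Ideal.span_singleton_le_iff_mem _).mpr hxm)
      obtain ⟨s, hs, hcard, k, hk⟩ := exists_finset_pow_le_sup (hne _ hI')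
      obtain ⟨F, hF, hFX, -⟩ := hf.exists_adjoin hxm
      obtain ⟨R, _, G, g, hG, hGg, hg⟩ := hF.exists_adjoin_finset s hs
      have := hf.isDomain
      refine hG.ringKrullDim_le ?_ (sup_le hI' (Ideal.span_le.mpr hs)) hk hP.le
        (hg _ PowerSeries.X_prime) ?_
      · apply le_antisymm
        · have h2 : ringKrullDim B ≤ ringKrullDim (B ⧸ Ideal.span {f ϖ} ⊔ Ideal.span {x}) + 2 := by
            have := ringKrullDim_le_ringKrullDim_quotient_add_encard (R := B) {f ϖ, x} (by
              rw [IsLocalRing.ringJacobson_eq_maximalIdeal]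
              rintro y (rfl | rfl)
              exacts [hϖm, hxm])
            rw [Ideal.span_insert] at this
            refine this.trans ?_
            gcongr
            exact WithBot.coe_le_coe.mpr
              ((Set.encard_insert_le _ _).trans (by rw [Set.encard_singleton]; rfl))
          refine h2.trans (le_of_eq ?_)
          rw [← hcard, Nat.cast_add, add_comm]
          rfl
        · have h2 := ringKrullDim_quotient_sup_succ_le _ hx
          rw [hd, ← hquot _ hϖ0 hϖm]
          rw [← hcard] at h2
          refine le_trans (le_of_eq ?_) (add_le_add_left h2 1)
          rw [Nat.cast_add, add_comm, add_assoc]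
          rfl
      · rw [← RingHom.comp_apply, hGg, hFX]
        exact hxP

/-- A maximal chain below `P` pulls back to a chain starting at a prime containing `q ≠ ⊥`, so `⊥`
can be prepended. -/
theorem Ideal.height_add_one_le_height_comap_mk {B : Type*} [CommRing B] [IsDomain B]
    [IsNoetherianRing B] {q : Ideal B} (hq : q ≠ ⊥) (P : Ideal (B ⧸ q)) [P.IsPrime] :
    P.height + 1 ≤ (P.comap (Ideal.Quotient.mk q)).height := by
  obtain ⟨l, hl, hlen⟩ := P.exists_ltSeries_length_eq_height
  have hmono : StrictMono (PrimeSpectrum.comap (Ideal.Quotient.mk q)) := fun p p' h => by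
    refine lt_of_le_of_ne (Ideal.comap_mono h.le) fun he => h.ne ?_
    exact PrimeSpectrum.comap_injective_of_surjective _ Ideal.Quotient.mk_surjective he
  let l' := l.map _ hmono
  have hbot : (⊥ : PrimeSpectrum B) < l'.head := by
    rw [bot_lt_iff_ne_bot]
    intro h
    apply hq
    rw [← le_bot_iff]
    have h1 : q ≤ l'.head.asIdeal := by
      rw [LTSeries.head_map, PrimeSpectrum.comap_asIdeal]
      conv_lhs => rw [← Ideal.mk_ker (I := q), RingHom.ker_eq_comap_bot]
      exact Ideal.comap_mono bot_le
    rw [h] at h1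
    exact h1
  have h2 := Order.length_le_height_last (p := l'.cons ⊥ hbot)
  rw [RelSeries.last_cons, LTSeries.last_map, hl, ← PrimeSpectrum.height_eq_orderHeight] at h2
  rw [← hlen]
  simpa [l'] using h2

/-! ### Coefficient fields in residue characteristic zero -/

theorem IsNormalCover.of_isField {K B : Type*} [CommRing K] (hK : IsField K) [CommRing B]
    [IsLocalRing B] (f : K →+* B) (hf : ∀ b, ∃ r, b - f r ∈ maximalIdeal B) :
    IsNormalCover f ⊥ 0 := by
  let := hK.toField
  have hbot : maximalIdeal K = ⊥ := maximalIdeal_eq_bot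
  refine ⟨inferInstance, inferInstance, inferInstance, inferInstance, ?_, ?_, ?_, hf⟩
  · rw [hbot]; infer_instance
  · rw [ringKrullDim_eq_zero_of_isField hK]; rfl
  · rw [hbot, Ideal.map_bot]

/-- Nonzero integers are units, so `B` is a `ℚ`-algebra. The residue field is separable algebraic
over a purely transcendental extension of `ℚ`, hence formally smooth, and its identity map lifts
through the complete ring `B`. -/
theorem HasCoefficientRing.of_charZero.{u} (B : Type u) [CommRing B] [IsLocalRing B]
    [IsAdicComplete (maximalIdeal B) B] [CharZero (ResidueField B)] : HasCoefficientRing B := by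
  have hunit : ∀ n : ℤ, n ≠ 0 → IsUnit (n : B) := fun n hn => by
    by_contra h
    have h1 : residue B (n : B) = 0 := (residue_eq_zero_iff _).mpr h
    rw [map_intCast, Int.cast_eq_zero] at h1
    exact hn h1
  let : Algebra ℚ B := (IsLocalization.lift (M := nonZeroDivisors ℤ) (S := ℚ) (g := Int.castRingHom B)
    fun n => hunit n (nonZeroDivisors.ne_zero n.2)).toAlgebra
  obtain ⟨s, hs⟩ := exists_isTranscendenceBasis ℚ (ResidueField B)
  have halg : Algebra.IsAlgebraic (IntermediateField.adjoin ℚ (Set.range ((↑) : s → ResidueField B)))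
    (ResidueField B) := hs.isAlgebraic_field
  have : Algebra.FormallySmooth ℚ (ResidueField B) :=
    .of_algebraicIndependent_of_isSeparable hs.1
  obtain ⟨g, hg⟩ := Algebra.FormallySmooth.exists_mkₐ_comp_eq_of_isAdicComplete
    (I := maximalIdeal B) (A := ResidueField B)
    (RingHom.toRatAlgHom (S := B ⧸ maximalIdeal B) (RingHom.id (ResidueField B)))
  refine ⟨ResidueField B, inferInstance, g.toRingHom,
    .inl (.of_isField (Field.toIsField _) _ fun b => ?_)⟩
  refine ⟨residue B b, ?_⟩
  rw [← residue_eq_zero_iff, map_sub, sub_eq_zero]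
  exact (DFunLike.congr_fun hg (residue B b)).symm

/-! ### Bases of differentials in characteristic `p` -/

/-- A family `b` in a field of characteristic `p` such that the monomials in `b` with exponents
less than `p` form a basis over the subfield of `p`-th powers. -/
structure IsPBasis {ι k : Type*} [Field k] (p : ℕ) [ExpChar k p] (b : ι → k) : Prop where
  surjective : Function.Surjective (MvPolynomial.eval₂Hom (frobenius k p) b)
  eq_zero : ∀ f : MvPolynomial ι k, (∀ e ∈ f.support, ∀ i, e i < p) →
    MvPolynomial.eval₂Hom (frobenius k p) b f = 0 → f = 0

namespace IsPBasis

open MvPolynomial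

/-- If `a ∉ L`, then `X ^ p - a ^ p` is irreducible over `L`, so `a` satisfies no nonzero relation
of degree below `p`. -/
theorem mem_of_sum_eq_zero {k : Type*} [Field k] {p : ℕ} [hp : Fact p.Prime] [CharP k p]
    (L : Subfield k) {a : k} (hap : a ^ p ∈ L) (l : ℕ → k) (hl : ∀ j, l j ∈ L)
    (h : ∑ j ∈ Finset.range p, l j * a ^ j = 0) {j : ℕ} (hj : j < p) (hlj : l j ≠ 0) : a ∈ L := by
  by_contra ha
  have hirr : Irreducible (Polynomial.X ^ p - Polynomial.C (⟨a ^ p, hap⟩ : L)) := by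
    apply X_pow_sub_C_irreducible_of_prime hp.out
    intro b hb
    have h1 : (b : k) ^ p = a ^ p := congrArg Subtype.val hb
    exact ha (frobenius_inj k p h1 ▸ b.2)
  have hmap : ∀ x : L, algebraMap L k x = x := fun _ => rfl
  have hmin := minpoly.eq_of_irreducible_of_monic hirr (x := a) (by simp [hmap])
    (Polynomial.monic_X_pow_sub_C _ hp.out.ne_zero)
  let g : Polynomial L := ∑ j ∈ Finset.range p, Polynomial.C ⟨l j, hl j⟩ * Polynomial.X ^ j
  have hg : g ≠ 0 := fun h0 => by
    have := congrArg (Polynomial.coeff · j) h0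
    simp only [g, Polynomial.finsetSum_coeff, Polynomial.coeff_C_mul, Polynomial.coeff_X_pow,
      Polynomial.coeff_zero] at this
    rw [Finset.sum_eq_single_of_mem j (Finset.mem_range.mpr hj)
      (fun i _ hi => by simp [Ne.symm hi])] at this
    apply hlj
    simpa using congrArg Subtype.val this
  have hga : Polynomial.aeval a g = 0 := by
    simpa [g, hmap] using h
  have h1 := minpoly.degree_le_of_ne_zero L a hg hga
  rw [← hmin, Polynomial.degree_X_pow_sub_C hp.out.pos] at h1
  have h2 : g.degree < p := by
    refine lt_of_le_of_lt (Polynomial.degree_sum_le _ _) ?_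
    rw [Finset.sup_lt_iff (by exact WithBot.bot_lt_coe _)]
    intro i hi
    exact lt_of_le_of_lt (Polynomial.degree_C_mul_X_pow_le _ _)
      (by exact_mod_cast Finset.mem_range.mp hi)
  exact absurd h1 (not_le.mpr h2)

/-- Zorn's lemma yields a maximal `p`-independent set `T`; maximality forces `k ^ p[T]` to be all of
`k`. -/
theorem exists_isPBasis (k : Type*) [Field k] (p : ℕ) [hp : Fact p.Prime] [CharP k p] :
    ∃ T : Set k, IsPBasis p ((↑) : T → k) := by
  classical
  let Ind : Set k → Prop := fun T => ∀ f : MvPolynomial k k, (f.vars : Set k) ⊆ T →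
    (∀ e ∈ f.support, ∀ i, e i < p) → eval₂Hom (frobenius k p) id f = 0 → f = 0
  obtain ⟨T, hT⟩ := zorn_subset {T | Ind T} (by
    intro c hc hchain
    by_cases hne : c.Nonempty
    · refine ⟨⋃₀ c, fun f hf => ?_, fun s hs => Set.subset_sUnion_of_mem hs⟩
      obtain ⟨s, hs, hfs⟩ := DirectedOn.exists_mem_subset_of_finset_subset_biUnion hne
        (f := id) (s := f.vars) hchain.directedOn (by simpa [Set.sUnion_eq_biUnion] using hf)
      exact hc hs f hfs
    · refine ⟨∅, fun f hf hf' hf0 => ?_, fun s hs => (hne ⟨s, hs⟩).elim⟩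
      have : f.vars = ∅ := by simpa using hf
      rw [vars_eq_empty_iff_eq_C] at this
      rw [this] at hf0 ⊢
      have : frobenius k p (coeff 0 f) = 0 := by simpa using hf0
      rw [(map_eq_zero _).mp this, C_0])
  let L : Subfield k :=
    { Subring.closure (Set.range (frobenius k p) ∪ T) with
      inv_mem' := fun x hx => by
        by_cases hx0 : x = 0
        · rw [hx0, inv_zero]
          exact zero_mem (Subring.closure (Set.range (frobenius k p) ∪ T))
        -- This is why adjoining `T` to the `p`-th powers as a ring already gives a field.
        have h1 : x⁻¹ = x ^ (p - 1) * frobenius k p x⁻¹ := by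
          rw [frobenius_def, inv_pow, eq_comm, mul_inv_eq_iff_eq_mul₀ (pow_ne_zero _ hx0)]
          obtain ⟨q, hq⟩ := Nat.exists_eq_succ_of_ne_zero hp.out.ne_zero
          rw [hq, Nat.succ_sub_one, pow_succ]
          field_simp
        rw [h1]
        exact mul_mem (pow_mem hx _) (Subring.subset_closure (.inl ⟨_, rfl⟩)) }
  have hLT : T ⊆ L := fun x hx => Subring.subset_closure (.inr hx)
  have hLp : ∀ x : k, x ^ p ∈ L := fun x => Subring.subset_closure (.inl ⟨x, rfl⟩)
  have hmemL : ∀ f : MvPolynomial k k, (f.vars : Set k) ⊆ T →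
      eval₂Hom (frobenius k p) id f ∈ L := by
    intro f hf
    rw [coe_eval₂Hom, eval₂_eq]
    refine sum_mem fun e he => mul_mem (hLp _) (prod_mem fun i hi => pow_mem (hLT (hf ?_)) _)
    exact (mem_vars_iff_mem_support (i := i)).mpr ⟨e, he, hi⟩
  have hL : ∀ a, a ∈ L := by
    intro a
    by_contra ha
    have haT : a ∉ T := fun h => ha (hLT h)
    -- A relation is sorted by powers of `a`. Its coefficients evaluate into `L`, so they vanish
    -- because `a ∉ L`, and independence of `T` kills the polynomials behind them.
    suffices Ind (insert a T) from haT (hT.2 this (Set.subset_insert _ _) (Set.mem_insert _ _))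
    intro f hfv hfp hf0
    let F : ℕ → MvPolynomial k k := fun j =>
      ∑ e ∈ f.support with e a = j, monomial (e.erase a) (coeff e f)
    have hF : f = ∑ j ∈ Finset.range p, F j * X a ^ j := by
      conv_lhs => rw [f.as_sum]
      rw [← Finset.sum_fiberwise_of_maps_to (g := fun e => e a) (t := Finset.range p)
        (fun e he => Finset.mem_range.mpr (hfp e he a))]
      refine Finset.sum_congr rfl fun j _ => ?_
      rw [Finset.sum_mul]
      refine Finset.sum_congr rfl fun e he => ?_
      rw [Finset.mem_filter] at he
      rw [X_pow_eq_monomial, monomial_mul, mul_one, ← he.2, Finsupp.erase_add_single]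
    have hFsupp : ∀ j, ∀ e' ∈ (F j).support, ∃ e ∈ f.support, e' = e.erase a := by
      intro j e' he'
      obtain ⟨e, he, he''⟩ := Finset.mem_biUnion.mp (support_sum he')
      refine ⟨e, (Finset.mem_filter.mp he).1, ?_⟩
      simpa using Finset.mem_of_subset support_monomial_subset he''
    have hFv : ∀ j, ((F j).vars : Set k) ⊆ T := by
      intro j i hi
      obtain ⟨e', he', hi'⟩ := (mem_vars_iff_mem_support (i := i)).mp hi
      obtain ⟨e, he, rfl⟩ := hFsupp j e' he'
      rw [Finsupp.support_erase, Finset.mem_erase] at hi'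
      have := hfv ((mem_vars_iff_mem_support (i := i)).mpr ⟨e, he, hi'.2⟩)
      exact this.resolve_left hi'.1
    have hFp : ∀ j, ∀ e' ∈ (F j).support, ∀ i, e' i < p := by
      intro j e' he' i
      obtain ⟨e, he, rfl⟩ := hFsupp j e' he'
      rw [Finsupp.erase_apply]
      split_ifs
      · exact hp.out.pos
      · exact hfp e he i
    rw [hF]
    refine Finset.sum_eq_zero fun j hj => ?_
    have : F j = 0 := by
      apply hT.1 (F j) (hFv j) (hFp j)
      by_contra hne
      refine ha (mem_of_sum_eq_zero L (hLp a) (fun j => eval₂Hom (frobenius k p) id (F j))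
        (fun j => hmemL _ (hFv j)) ?_ (Finset.mem_range.mp hj) hne)
      rw [hF] at hf0
      simpa using hf0
    rw [this, zero_mul]
  refine ⟨T, ?_, fun f hf hf0 => ?_⟩
  · intro a
    have : Subring.closure (Set.range (frobenius k p) ∪ T) ≤
        (eval₂Hom (frobenius k p) ((↑) : T → k)).range := by
      rw [Subring.closure_le]
      rintro _ (⟨x, rfl⟩ | hx)
      · exact ⟨C x, by simp⟩
      · exact ⟨X ⟨_, hx⟩, by simp⟩
    exact this (hL a)
  · apply rename_injective _ Subtype.val_injective
    rw [map_zero]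
    apply hT.1
    · intro i hi
      obtain ⟨j, -, rfl⟩ := Finset.mem_image.mp (vars_rename _ f hi)
      exact j.2
    · intro e he i
      rw [support_rename_of_injective Subtype.val_injective] at he
      obtain ⟨e', he', rfl⟩ := Finset.mem_image.mp he
      by_cases hi : i ∈ Set.range (Subtype.val : T → k)
      · obtain ⟨j, rfl⟩ := hi
        rw [Finsupp.mapDomain_apply Subtype.val_injective]
        exact hf e' he' j
      · rw [Finsupp.mapDomain_of_notMem_range _ _ hi]
        exact hp.out.pos
    · rw [coe_eval₂Hom, eval₂_rename]
      exact hf0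

variable {ι k : Type*} [Field k] {p : ℕ} [hp : Fact p.Prime] [CharP k p] {b : ι → k}

theorem surjective_iterateFrobenius (hb : IsPBasis p b) (n : ℕ) :
    Function.Surjective (eval₂Hom (iterateFrobenius k p n) b) := by
  rw [← RingHom.range_eq_top]
  induction n with
  | zero =>
    rw [RingHom.range_eq_top]
    exact fun a => ⟨C a, by simp⟩
  | succ n ih =>
    rw [← top_le_iff, ← ih]
    have hX : ∀ i, b i ∈ (eval₂Hom (iterateFrobenius k p (n + 1)) b).range :=
      fun i => ⟨X i, by simp⟩
    have hC : ∀ c, c ^ p ^ (n + 1) ∈ (eval₂Hom (iterateFrobenius k p (n + 1)) b).range :=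
      fun c => ⟨C c, by simp [iterateFrobenius_def]⟩
    rintro _ ⟨f, rfl⟩
    rw [coe_eval₂Hom, eval₂_eq]
    refine sum_mem fun e _ => mul_mem ?_ (prod_mem fun i _ => pow_mem (hX i) _)
    obtain ⟨g, hg⟩ := hb.surjective (coeff e f)
    rw [← hg, coe_eval₂Hom, eval₂_eq, map_sum]
    refine sum_mem fun e' _ => ?_
    rw [map_mul, map_prod]
    refine mul_mem ?_ (prod_mem fun i _ => ?_)
    · rw [iterateFrobenius_def, frobenius_def, ← pow_mul, ← pow_succ']
      exact hC _
    · rw [map_pow, iterateFrobenius_def]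
      exact pow_mem (pow_mem (hX i) _) _

/-- Splitting exponents as `r + p * q` turns `f` into a sum of reduced monomials times expansions of
polynomials `G`. By `p`-independence each `G` vanishes one level down, and expansion carries the
level `n` generators to those of level `n + 1`. -/
theorem mem_span_of_eval₂_eq_zero (hb : IsPBasis p b) (n : ℕ) (f : MvPolynomial ι k)
    (hf : eval₂Hom (iterateFrobenius k p n) b f = 0) :
    f ∈ Ideal.span (Set.range fun i => X i ^ p ^ n - C (b i) : Set (MvPolynomial ι k)) := by
  classical
  induction n generalizing f with
  | zero =>
    rw [← Ideal.Quotient.eq_zero_iff_mem]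
    set I := Ideal.span (Set.range fun i => X i ^ p ^ 0 - C (b i) : Set (MvPolynomial ι k))
    have h1 : Ideal.Quotient.mk I =
        ((Ideal.Quotient.mk I).comp C).comp (eval₂Hom (iterateFrobenius k p 0) b) := by
      apply ringHom_ext
      · intro r; simp
      · intro i
        have : X i - C (b i) ∈ I := Ideal.subset_span ⟨i, by simp⟩
        rw [← Ideal.Quotient.eq_zero_iff_mem, map_sub, sub_eq_zero] at this
        simpa using this
    rw [h1, RingHom.comp_apply, hf, map_zero]
  | succ n ih =>
    let q : (ι →₀ ℕ) → (ι →₀ ℕ) := fun e => e.mapRange (· / p) (Nat.zero_div p)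
    let r : (ι →₀ ℕ) → (ι →₀ ℕ) := fun e => e.mapRange (· % p) (Nat.zero_mod p)
    have hqr : ∀ e, r e + p • q e = e := fun e => by
      ext i; simp [q, r, Nat.mod_add_div]
    let G : (ι →₀ ℕ) → MvPolynomial ι k := fun e' =>
      ∑ e ∈ f.support with r e = e', monomial (q e) (coeff e f)
    have hG : f = ∑ e' ∈ f.support.image r, monomial e' 1 * expand p (G e') := by
      conv_lhs => rw [f.as_sum]
      rw [← Finset.sum_fiberwise_of_maps_to (g := r) (t := f.support.image r)
        (fun e he => Finset.mem_image_of_mem r he)]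
      refine Finset.sum_congr rfl fun e' _ => ?_
      rw [map_sum, Finset.mul_sum]
      refine Finset.sum_congr rfl fun e he => ?_
      rw [Finset.mem_filter] at he
      rw [expand_monomial, monomial_mul, one_mul, ← he.2, hqr]
    have hexp : ∀ g : MvPolynomial ι k, eval₂Hom (iterateFrobenius k p (n + 1)) b (expand p g) =
        eval₂Hom (iterateFrobenius k p n) b g ^ p := by
      intro g
      have : (eval₂Hom (iterateFrobenius k p (n + 1)) b).comp (expand p : _ →ₐ[k] _).toRingHom =
          (frobenius k p).comp (eval₂Hom (iterateFrobenius k p n) b) := by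
        apply ringHom_ext
        · intro c
          simp [iterateFrobenius_def, frobenius_def, pow_succ, pow_mul]
        · intro i; simp [frobenius_def]
      exact RingHom.congr_fun this g
    have hH : ∑ e' ∈ f.support.image r,
        monomial e' (eval₂Hom (iterateFrobenius k p n) b (G e')) = 0 := by
      apply hb.eq_zero
      · intro e he i
        obtain ⟨e', he', he''⟩ := Finset.mem_biUnion.mp (support_sum he)
        obtain ⟨e₀, -, rfl⟩ := Finset.mem_image.mp he'
        obtain rfl : e = r e₀ := by simpa using Finset.mem_of_subset support_monomial_subset he''
        exact Nat.mod_lt _ hp.out.pos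
      · rw [hG, map_sum] at hf
        rw [map_sum, ← hf]
        refine Finset.sum_congr rfl fun e' _ => ?_
        rw [map_mul, hexp]
        simp [eval₂_monomial, frobenius_def, mul_comm]
    have hG0 : ∀ e' ∈ f.support.image r, eval₂Hom (iterateFrobenius k p n) b (G e') = 0 := by
      intro e' he'
      have := congrArg (coeff e') hH
      rw [coeff_sum, coeff_zero, Finset.sum_eq_single_of_mem e' he' fun e _ hne => by
        rw [coeff_monomial, if_neg hne]] at this
      simpa using this
    rw [hG]
    refine sum_mem fun e' he' => Ideal.mul_mem_left _ _ ?_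
    have h1 := Ideal.mem_map_of_mem (expand p : MvPolynomial ι k →ₐ[k] _).toRingHom
      (ih (G e') (hG0 e' he'))
    refine Ideal.map_le_iff_le_comap.mpr ?_ h1
    rw [Ideal.span_le]
    rintro _ ⟨i, rfl⟩
    refine Ideal.subset_span ⟨i, ?_⟩
    simp [pow_succ', pow_mul]

end IsPBasis

/-! ### Coefficient rings in positive residue characteristic -/

namespace CoefficientRing

open MvPolynomial WittVector

theorem ghostComponent_eq_sum {B : Type*} [CommRing B] {p : ℕ} [Fact p.Prime] (n : ℕ)
    (x : WittVector p B) :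
    ghostComponent n x = ∑ i ∈ Finset.range (n + 1), (p : B) ^ i * x.coeff i ^ p ^ (n - i) := by
  rw [ghostComponent_apply, aeval_wittPolynomial]

theorem natCast_mem_maximalIdeal {B : Type*} [CommRing B] [IsLocalRing B] {p : ℕ}
    [CharP (ResidueField B) p] : (p : B) ∈ maximalIdeal B := by
  rw [← residue_eq_zero_iff, map_natCast, CharP.cast_eq_zero]

variable {B ι : Type*} [CommRing B] [IsLocalRing B] {p : ℕ} [hp : Fact p.Prime]

/-- The ghost component is `x₀ ^ p ^ (n + 1)` plus `p` times the previous ghost component of the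
shifted vector, and the first term is negligible because `p ^ (n + 1) ≥ n + 2`. -/
theorem exists_ghostComponent_sub_mem [CharP (ResidueField B) p] (n : ℕ) {x : WittVector p B}
    (hx : x.coeff 0 ∈ maximalIdeal B) :
    ∃ y : WittVector p B, ghostComponent (n + 1) x - p * ghostComponent n y ∈
      maximalIdeal B ^ (n + 2) := by
  refine ⟨WittVector.mk p fun i => x.coeff (i + 1), ?_⟩
  have h1 : ghostComponent (n + 1) x -
      p * ghostComponent n (WittVector.mk p fun i => x.coeff (i + 1)) = x.coeff 0 ^ p ^ (n + 1) := by
    rw [ghostComponent_eq_sum, ghostComponent_eq_sum, Finset.sum_range_succ', Finset.mul_sum]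
    have : ∀ i ∈ Finset.range (n + 1), (p : B) ^ (i + 1) * x.coeff (i + 1) ^ p ^ (n + 1 - (i + 1)) =
        p * (p ^ i * (WittVector.mk p fun i => x.coeff (i + 1)).coeff i ^ p ^ (n - i)) := by
      intro i _
      rw [coeff_mk, Nat.add_sub_add_right]
      ring
    rw [Finset.sum_congr rfl this]
    simp
  rw [h1]
  exact Ideal.pow_le_pow_right (Nat.lt_pow_self hp.out.one_lt) (Ideal.pow_mem_pow hx _)

theorem residue_ghostComponent [CharP (ResidueField B) p] (n : ℕ) (x : WittVector p B) :
    residue B (ghostComponent n x) = residue B (x.coeff 0) ^ p ^ n := by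
  rw [ghostComponent_eq_sum, Finset.sum_range_succ']
  simp

/-- The homomorphism to `B` from polynomials over the Witt vectors of `B`, given by the `n`-th
ghost component on the coefficients and by `c` on the variables. -/
noncomputable def ghostEval (p : ℕ) [Fact p.Prime] (c : ι → B) (n : ℕ) :
    MvPolynomial ι (WittVector p B) →+* B :=
  eval₂Hom (ghostComponent n) c

/-- The elements of `B` congruent modulo `𝔪 ^ (n + 1)` to an element of the range of
`ghostEval`. -/
noncomputable def approx (p : ℕ) [Fact p.Prime] (c : ι → B) (n : ℕ) : Subring B :=
  ((Ideal.Quotient.mk (maximalIdeal B ^ (n + 1))).comp (ghostEval p c n)).range.comap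
    (Ideal.Quotient.mk (maximalIdeal B ^ (n + 1)))

/-- The coefficient ring attached to a lift `c` of a `p`-basis of the residue field. -/
noncomputable def coefRing (p : ℕ) [Fact p.Prime] (c : ι → B) : Subring B := ⨅ n, approx p c n

variable {c : ι → B}

theorem mem_approx {n : ℕ} {y : B} :
    y ∈ approx p c n ↔ ∃ f, y - ghostEval p c n f ∈ maximalIdeal B ^ (n + 1) := by
  simp only [approx, Subring.mem_comap, RingHom.mem_range, RingHom.comp_apply]
  refine exists_congr fun f => ?_
  rw [eq_comm, Ideal.Quotient.eq]

theorem mem_coefRing {y : B} : y ∈ coefRing p c ↔ ∀ n, y ∈ approx p c n := by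
  simp [coefRing, Subring.mem_iInf]

theorem ghostEval_mem_approx (n : ℕ) (f : MvPolynomial ι (WittVector p B)) :
    ghostEval p c n f ∈ approx p c n :=
  mem_approx.mpr ⟨f, by simp⟩

theorem mem_approx_of_mem_pow {n : ℕ} {y : B} (hy : y ∈ maximalIdeal B ^ (n + 1)) :
    y ∈ approx p c n :=
  mem_approx.mpr ⟨0, by simpa using hy⟩

theorem mem_approx_of_sub_mem {n : ℕ} {x y : B} (hx : x ∈ approx p c n)
    (hxy : y - x ∈ maximalIdeal B ^ (n + 1)) : y ∈ approx p c n := by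
  simpa using add_mem (mem_approx_of_mem_pow hxy) hx

theorem approx_antitone : Antitone (approx p c) := by
  refine antitone_nat_of_succ_le fun n y hy => ?_
  obtain ⟨f, hf⟩ := mem_approx.mp hy
  -- The Witt vector Frobenius converts the ghost component of index `n + 1` into that of index `n`.
  refine mem_approx.mpr ⟨map WittVector.frobenius f, ?_⟩
  have : ghostEval p c n (map WittVector.frobenius f) = ghostEval p c (n + 1) f := by
    rw [ghostEval, coe_eval₂Hom, eval₂_map, ghostEval, coe_eval₂Hom]
    congr 1
    exact RingHom.ext fun x => ghostComponent_frobenius n x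
  rw [this]
  exact Ideal.pow_le_pow_right (Nat.le_succ _) hf

variable [CharP (ResidueField B) p]

/-- Write the residue of `x₀` as a polynomial in the `p`-basis with `p ^ (n - j)`-th powers as
coefficients, and take the sum of Teichmüller lifts of its terms. Raising to the power `p ^ j` makes
the coefficients `p ^ n`-th powers, that is, level `n` ghost components. -/
theorem exists_ghostComponent_mem_approx (hc : IsPBasis p (fun i => residue B (c i))) {j n : ℕ}
    (hj : j ≤ n) (x : WittVector p B) :
    ∃ w : WittVector p B, ghostComponent j w ∈ approx p c n ∧ x.coeff 0 - w.coeff 0 ∈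
      maximalIdeal B := by
  obtain ⟨f, hf⟩ := hc.surjective_iterateFrobenius (n - j) (residue B (x.coeff 0))
  choose σ hσ using residue_surjective (R := B)
  let w : WittVector p B := ∑ e ∈ f.support,
    teichmuller p (σ (coeff e f) ^ p ^ (n - j) * e.prod fun i m => c i ^ m)
  refine ⟨w, ?_, ?_⟩
  · have : ghostComponent j w = ghostEval p c n
        (∑ e ∈ f.support, monomial (p ^ j • e) (teichmuller p (σ (coeff e f)))) := by
      rw [map_sum, map_sum]
      refine Finset.sum_congr rfl fun e _ => ?_
      rw [ghostComponent_teichmuller, ghostEval, coe_eval₂Hom, eval₂_monomial,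
        ghostComponent_teichmuller, mul_pow, ← pow_mul, ← pow_add, Nat.sub_add_cancel hj]
      congr 1
      rw [Finsupp.prod_of_support_subset _ Finsupp.support_smul _ fun i _ => pow_zero _, Finsupp.prod,
        ← Finset.prod_pow]
      exact Finset.prod_congr rfl fun i _ => by
        rw [← pow_mul, mul_comm, Finsupp.smul_apply, smul_eq_mul]
    rw [this]
    exact ghostEval_mem_approx n _
  · rw [← residue_eq_zero_iff, map_sub, sub_eq_zero, ← hf, coe_eval₂Hom, eval₂_eq,
      ← WittVector.constantCoeff_apply, map_sum, map_sum]
    refine Finset.sum_congr rfl fun e _ => ?_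
    rw [WittVector.constantCoeff_apply, teichmuller_coeff_zero, map_mul, map_pow, hσ, Finsupp.prod,
      map_prod, iterateFrobenius_def]
    simp only [map_pow]

/-- After subtracting a Witt vector with the same residue, the ghost component is `p` times one of
lower index up to a negligible error; the factor `p` restores the power of `𝔪` lost in the
induction. -/
theorem exists_ghostComponent_sub_mem_approx (hc : IsPBasis p (fun i => residue B (c i))) {j n : ℕ}
    (hj : j ≤ n) (x : WittVector p B) :
    ∃ y ∈ approx p c n, ghostComponent j x - y ∈ maximalIdeal B ^ (j + 1) := by
  induction j generalizing x with
  | zero =>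
    obtain ⟨w, hw, hxw⟩ := exists_ghostComponent_mem_approx hc hj x
    refine ⟨_, hw, ?_⟩
    simpa [ghostComponent_eq_sum] using hxw
  | succ j ih =>
    obtain ⟨w, hw, hxw⟩ := exists_ghostComponent_mem_approx hc hj x
    obtain ⟨g, hg⟩ := exists_ghostComponent_sub_mem j (x := x - w) (by
      have h1 := map_sub (WittVector.constantCoeff (p := p) (R := B)) x w
      simp only [WittVector.constantCoeff_apply] at h1
      rwa [h1])
    obtain ⟨y, hy, hgy⟩ := ih (by omega) g
    refine ⟨ghostComponent (j + 1) w + p * y, add_mem hw (mul_mem (natCast_mem _ p) hy), ?_⟩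
    have h2 := Ideal.mul_mem_mul (natCast_mem_maximalIdeal (B := B) (p := p)) hgy
    rw [← pow_succ'] at h2
    rw [map_sub] at hg
    convert add_mem hg h2 using 1
    ring

/-- The successive approximations surject onto each other. -/
theorem exists_mem_approx_succ_sub_mem (hc : IsPBasis p (fun i => residue B (c i))) {n : ℕ} {y : B}
    (hy : y ∈ approx p c n) :
    ∃ z ∈ approx p c (n + 1), z - y ∈ maximalIdeal B ^ (n + 1) := by
  obtain ⟨f, hf⟩ := mem_approx.mp hy
  have key : ∀ f : MvPolynomial ι (WittVector p B), ∃ z ∈ approx p c (n + 1),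
      z - ghostEval p c n f ∈ maximalIdeal B ^ (n + 1) := by
    intro f
    induction f using MvPolynomial.induction_on with
    | C x =>
      obtain ⟨z, hz, hxz⟩ := exists_ghostComponent_sub_mem_approx hc (Nat.le_succ n) x
      exact ⟨z, hz, by rw [← neg_mem_iff]; simpa [ghostEval] using hxz⟩
    | add f g hf hg =>
      obtain ⟨z, hz, hz'⟩ := hf
      obtain ⟨w, hw, hw'⟩ := hg
      exact ⟨z + w, add_mem hz hw, by rw [map_add, add_sub_add_comm]; exact add_mem hz' hw'⟩
    | mul_X f i hf =>
      obtain ⟨z, hz, hz'⟩ := hf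
      refine ⟨z * c i, mul_mem hz ?_, ?_⟩
      · simpa [ghostEval] using ghostEval_mem_approx (p := p) (c := c) (n + 1) (X i)
      · have : ghostEval p c n (X i) = c i := by simp [ghostEval]
        rw [map_mul, this, ← sub_mul]
        exact Ideal.mul_mem_right _ _ hz'
  obtain ⟨z, hz, hz'⟩ := key f
  refine ⟨z, hz, ?_⟩
  convert sub_mem hz' hf using 1
  ring

/-- An element of the `n`-th approximation lying in the maximal ideal is a multiple of `p`. -/
theorem exists_sub_natCast_mul_mem (hc : IsPBasis p (fun i => residue B (c i))) {n : ℕ} {y : B}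
    (hy : y ∈ approx p c n) (hym : y ∈ maximalIdeal B) :
    ∃ z ∈ approx p c n, y - p * z ∈ maximalIdeal B ^ (n + 1) := by
  obtain ⟨f, hf⟩ := mem_approx.mp hy
  let r : WittVector p B →+* ResidueField B := (residue B).comp WittVector.constantCoeff
  have hr : Function.Surjective r :=
    residue_surjective.comp fun b => ⟨teichmuller p b, by simp⟩
  -- `J` lifts the kernel found in `mem_span_of_eval₂_eq_zero` and is killed by `ghostEval`.
  -- Subtracting an element of `J` therefore leaves a representative all of whose coefficients have
  -- residue zero.
  let J : Ideal (MvPolynomial ι (WittVector p B)) :=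
    Ideal.span (Set.range fun i => X i ^ p ^ n - C (teichmuller p (c i)))
  have hJ : J.map (map r) =
      Ideal.span (Set.range fun i => X i ^ p ^ n - C (residue B (c i))) := by
    rw [Ideal.map_span, ← Set.range_comp]
    congr 2
    ext1 i
    simp [r]
  have hJ0 : ∀ g ∈ J, ghostEval p c n g = 0 := by
    intro g hg
    have : J ≤ RingHom.ker (ghostEval p c n) := by
      rw [Ideal.span_le]
      rintro _ ⟨i, rfl⟩
      simp [RingHom.mem_ker, ghostEval, ghostComponent_teichmuller]
    exact this hg
  have hfJ : map r f ∈ J.map (map r) := by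
    rw [hJ]
    apply hc.mem_span_of_eval₂_eq_zero n
    have : (eval₂Hom (iterateFrobenius (ResidueField B) p n) fun i => residue B (c i)).comp
        (map r) = (residue B).comp (ghostEval p c n) := by
      apply ringHom_ext
      · intro x
        simp [r, ghostEval, iterateFrobenius_def, residue_ghostComponent]
      · intro i
        simp [ghostEval]
    rw [← RingHom.comp_apply, this, RingHom.comp_apply, residue_eq_zero_iff]
    have h1 := Ideal.pow_le_self (Nat.succ_ne_zero n) hf
    simpa using sub_mem hym h1
  obtain ⟨g, hg, hgf⟩ := (Ideal.mem_map_iff_of_surjective (map r) (map_surjective r hr)).mp hfJ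
  obtain ⟨h, hh, hhf⟩ : ∃ h, (∀ e, r (MvPolynomial.coeff e h) = 0) ∧
      ghostEval p c n h = ghostEval p c n f := by
    refine ⟨f - g, fun e => ?_, by rw [map_sub, hJ0 g hg, sub_zero]⟩
    rw [← coeff_map, map_sub, hgf, sub_self, coeff_zero]
  have hcoef : ∀ e, ∃ z ∈ approx p c n,
      ghostComponent n (MvPolynomial.coeff e h) - p * z ∈ maximalIdeal B ^ (n + 1) := by
    intro e
    have he : (MvPolynomial.coeff e h).coeff 0 ∈ maximalIdeal B := by
      rw [← residue_eq_zero_iff]; exact hh e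
    cases n with
    | zero => exact ⟨0, zero_mem _, by simpa [ghostComponent_eq_sum] using he⟩
    | succ n =>
      obtain ⟨x, hx⟩ := exists_ghostComponent_sub_mem n he
      obtain ⟨z, hz, hxz⟩ := exists_ghostComponent_sub_mem_approx hc (Nat.le_succ n) x
      refine ⟨z, hz, ?_⟩
      have h2 := Ideal.mul_mem_mul (natCast_mem_maximalIdeal (B := B) (p := p)) hxz
      rw [← pow_succ'] at h2
      convert add_mem hx h2 using 1
      ring
  choose z hz hz' using hcoef
  refine ⟨∑ e ∈ h.support, z e * ∏ i ∈ e.support, c i ^ e i,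
    sum_mem fun e _ => mul_mem (hz e) (prod_mem fun i _ => pow_mem ?_ _), ?_⟩
  · simpa [ghostEval] using ghostEval_mem_approx (p := p) (c := c) n (X i)
  · rw [← hhf] at hf
    have h3 : ghostEval p c n h - p * ∑ e ∈ h.support, z e * ∏ i ∈ e.support, c i ^ e i ∈
        maximalIdeal B ^ (n + 1) := by
      rw [ghostEval, coe_eval₂Hom, eval₂_eq, Finset.mul_sum, ← Finset.sum_sub_distrib]
      refine sum_mem fun e _ => ?_
      rw [← mul_assoc, ← sub_mul]
      exact Ideal.mul_mem_right _ _ (hz' e)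
    simpa using add_mem hf h3

end CoefficientRing

/-! ### Closedness of ideals, Artin–Rees cancellation and the structure of the coefficient ring -/

theorem IsLocalRing.mem_of_forall_mem_sup_pow {B : Type*} [CommRing B] [IsLocalRing B]
    [IsNoetherianRing B] {I : Ideal B} {x : B} (h : ∀ n, x ∈ I ⊔ maximalIdeal B ^ n) : x ∈ I := by
  have : IsHausdorff (maximalIdeal B) (B ⧸ I) :=
    .of_le_jacobson _ _ (maximalIdeal_le_jacobson _)
  rw [← Ideal.Quotient.eq_zero_iff_mem]
  refine this.haus' _ fun n => ?_
  rw [SModEq.zero]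
  obtain ⟨a, ha, b, hb, rfl⟩ := Submodule.mem_sup.mp (h n)
  rw [map_add, Ideal.Quotient.eq_zero_iff_mem.mpr ha, zero_add]
  have : Ideal.Quotient.mk I b = b • (1 : B ⧸ I) := by
    rw [Algebra.smul_def, mul_one]; rfl
  rw [this]
  exact Submodule.smul_mem_smul hb trivial

/-- Artin–Rees for `(a)`, followed by cancelling `a`. It controls division by `p` in the limit. -/
theorem Ideal.exists_forall_mem_pow_of_mul_mem_pow {B : Type*} [CommRing B] [IsNoetherianRing B]
    [IsDomain B] (I : Ideal B) {a : B} (ha : a ≠ 0) :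
    ∃ k, ∀ n x, a * x ∈ I ^ (n + k) → x ∈ I ^ n := by
  obtain ⟨k, hk⟩ := I.exists_pow_inf_eq_pow_smul (M := B) (Ideal.span {a})
  refine ⟨k, fun n x hx => ?_⟩
  have h1 : a * x ∈ I ^ (n + k) • (⊤ : Submodule B B) ⊓ Ideal.span {a} :=
    ⟨by simpa using hx, Ideal.mul_mem_right _ _ (Ideal.mem_span_singleton_self a)⟩
  rw [hk _ (Nat.le_add_left k n), Nat.add_sub_cancel] at h1
  have h2 : a * x ∈ I ^ n * Ideal.span {a} := by
    have := Submodule.smul_mono le_rfl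
      (inf_le_right : I ^ k • (⊤ : Submodule B B) ⊓ Ideal.span {a} ≤ _) h1
    simpa using this
  obtain ⟨y, hy, hya⟩ := Ideal.mem_mul_span_singleton.mp h2
  rw [mul_comm y] at hya
  rwa [← mul_left_cancel₀ ha hya]

namespace CoefficientRing

open MvPolynomial WittVector

variable {B ι : Type*} [CommRing B] [IsLocalRing B] {p : ℕ} [hp : Fact p.Prime] {c : ι → B}

theorem mem_coefRing_of_forall_sub_mem {L : B} {s : ℕ → B} (hs : ∀ n, s n ∈ coefRing p c)
    (hL : ∀ n, L - s n ∈ maximalIdeal B ^ n) : L ∈ coefRing p c :=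
  mem_coefRing.mpr fun n =>
    mem_approx_of_sub_mem (mem_coefRing.mp (hs (n + 1)) n) (hL (n + 1))

variable [CharP (ResidueField B) p]

theorem exists_mem_coefRing_sub_mem [IsPrecomplete (maximalIdeal B) B]
    (hc : IsPBasis p (fun i => residue B (c i))) (b : B) :
    ∃ r ∈ coefRing p c, b - r ∈ maximalIdeal B := by
  have hb : b ∈ approx p c 0 :=
    mem_approx.mpr ⟨C (teichmuller p b), by simp [ghostEval, ghostComponent_teichmuller]⟩
  choose next hnext hsub using fun (n : ℕ) (y : approx p c n) =>
    exists_mem_approx_succ_sub_mem hc y.2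
  let s : (n : ℕ) → approx p c n := fun n =>
    Nat.rec ⟨b, hb⟩ (fun n y => ⟨next n y, hnext n y⟩) n
  have hs : ∀ n, (s (n + 1)).1 - (s n).1 ∈ maximalIdeal B ^ (n + 1) := fun n => hsub n (s n)
  obtain ⟨L, hL⟩ := IsPrecomplete.exists_sub_mem (maximalIdeal B) (fun n => (s n).1) fun n =>
    Ideal.pow_le_pow_right (Nat.le_succ n) (hs n)
  have hL' : ∀ n, L - (s n).1 ∈ maximalIdeal B ^ (n + 1) := fun n => by
    simpa using add_mem (hL (n + 1)) (hs n)
  refine ⟨L, mem_coefRing.mpr fun n => mem_approx_of_sub_mem (s n).2 (hL' n), ?_⟩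
  rw [← neg_mem_iff, neg_sub]
  have h0 := hL' 0
  rw [zero_add, pow_one] at h0
  exact h0

theorem exists_mem_coefRing_eq_natCast_mul [IsNoetherianRing B] [IsDomain B]
    (hc : IsPBasis p (fun i => residue B (c i))) {y : B} (hy : y ∈ coefRing p c)
    (hym : y ∈ maximalIdeal B) : ∃ z ∈ coefRing p c, y = p * z := by
  choose μ hμ hyμ using fun n => exists_sub_natCast_mul_mem hc (mem_coefRing.mp hy n) hym
  have hy : y ∈ Ideal.span {(p : B)} := by
    refine mem_of_forall_mem_sup_pow fun n => ?_
    have h1 := Ideal.pow_le_pow_right (Nat.le_succ n) (hyμ n)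
    rw [← sub_add_cancel y (p * μ n)]
    exact add_mem (Ideal.mem_sup_right h1) (Ideal.mem_sup_left
      (Ideal.mul_mem_right _ _ (Ideal.mem_span_singleton_self _)))
  obtain ⟨z, rfl⟩ := Ideal.mem_span_singleton.mp hy
  by_cases h0 : (p : B) = 0
  · exact ⟨0, zero_mem _, by rw [h0, zero_mul, zero_mul]⟩
  obtain ⟨k, hk⟩ := (maximalIdeal B).exists_forall_mem_pow_of_mul_mem_pow h0
  refine ⟨z, mem_coefRing.mpr fun n => ?_, rfl⟩
  -- The quotient is the limit of the `μ`; going `k` levels further compensates for the Artin–Rees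
  -- loss in dividing by `p`.
  refine mem_approx_of_sub_mem (approx_antitone (Nat.le_add_right n k) (hμ (n + k))) ?_
  refine hk _ _ ?_
  rw [mul_sub, add_right_comm]
  exact hyμ (n + k)

theorem isUnit_coefRing [IsPrecomplete (maximalIdeal B) B]
    (hc : IsPBasis p (fun i => residue B (c i))) (y : coefRing p c)
    (hy : (y : B) ∉ maximalIdeal B) : IsUnit y := by
  obtain ⟨u, hu⟩ := (notMem_maximalIdeal.mp hy).exists_right_inv
  obtain ⟨μ, hμ, huμ⟩ := exists_mem_coefRing_sub_mem hc u
  set ν : B := 1 - y * μ with hν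
  have hνm : ν ∈ maximalIdeal B := by
    have := Ideal.mul_mem_left _ (y : B) huμ
    rwa [mul_sub, hu] at this
  have hνc : ν ∈ coefRing p c := sub_mem (one_mem _) (mul_mem y.2 hμ)
  have huc : u ∈ coefRing p c := by
    -- The inverse taken in `B` is a limit of geometric sums with terms in the coefficient ring,
    -- which is closed.
    refine mem_coefRing_of_forall_sub_mem (s := fun n => μ * ∑ i ∈ Finset.range n, ν ^ i)
      (fun n => mul_mem hμ (sum_mem fun i _ => pow_mem hνc i)) fun n => ?_
    have h1 : (∑ i ∈ Finset.range n, ν ^ i) * (1 - ν) = 1 - ν ^ n := geom_sum_mul_neg ν n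
    have h2 : u - μ * ∑ i ∈ Finset.range n, ν ^ i = u * ν ^ n := by
      linear_combination (-u) * h1 + (∑ i ∈ Finset.range n, ν ^ i) * (μ * hu + u * hν)
    rw [h2]
    exact Ideal.mul_mem_left _ _ (Ideal.pow_mem_pow hνm n)
  exact .of_mul_eq_one ⟨u, huc⟩ (Subtype.ext hu)

/-- Elements of `𝔪` can be divided by `p`, and separatedness of `B` makes this stop at a unit. -/
theorem exists_associated_pow_coefRing [IsNoetherianRing B] [IsDomain B]
    [IsPrecomplete (maximalIdeal B) B] (hc : IsPBasis p (fun i => residue B (c i)))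
    {y : coefRing p c} (hy : y ≠ 0) : ∃ n : ℕ, Associated ((p : coefRing p c) ^ n) y := by
  have key : ∀ (n : ℕ) (y : coefRing p c), (y : B) ∉ maximalIdeal B ^ n →
      ∃ n : ℕ, Associated ((p : coefRing p c) ^ n) y := by
    intro n
    induction n with
    | zero => intro y h; simp at h
    | succ n ih =>
      intro y h
      by_cases hym : (y : B) ∈ maximalIdeal B
      · obtain ⟨z, hz, hyz⟩ := exists_mem_coefRing_eq_natCast_mul hc y.2 hym
        obtain ⟨k, hk⟩ := ih ⟨z, hz⟩ fun h1 => h <| by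
          rw [hyz, pow_succ']
          exact Ideal.mul_mem_mul natCast_mem_maximalIdeal h1
        refine ⟨k + 1, ?_⟩
        have : y = p * ⟨z, hz⟩ := Subtype.ext hyz
        rw [this, pow_succ']
        exact hk.mul_left _
      · refine ⟨0, ?_⟩
        rw [pow_zero]
        exact (associated_one_iff_isUnit.mpr (isUnit_coefRing hc y hym)).symm
  by_contra! hcon
  apply hy
  refine Subtype.ext ((isHausdorff_maximalIdeal B).haus' _ fun n => ?_)
  rw [SModEq.zero, smul_eq_mul, Ideal.mul_top]
  by_contra h
  obtain ⟨k, hk⟩ := key n y h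
  exact hcon k hk

theorem isField_coefRing [IsNoetherianRing B] [IsDomain B] [IsPrecomplete (maximalIdeal B) B]
    (hc : IsPBasis p (fun i => residue B (c i))) (h0 : (p : B) = 0) : IsField (coefRing p c) where
  exists_pair_ne := ⟨0, 1, zero_ne_one⟩
  mul_comm := mul_comm
  mul_inv_cancel {y} hy := by
    refine (isUnit_coefRing hc y fun hym => hy ?_).exists_right_inv
    obtain ⟨z, -, hz⟩ := exists_mem_coefRing_eq_natCast_mul hc y.2 hym
    exact Subtype.ext (by rw [hz, h0, zero_mul]; rfl)

theorem prime_natCast_coefRing [IsNoetherianRing B] [IsDomain B] [IsPrecomplete (maximalIdeal B) B]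
    (hc : IsPBasis p (fun i => residue B (c i))) (h0 : (p : B) ≠ 0) :
    Prime (p : coefRing p c) := by
  refine ⟨fun h => h0 (by simpa using congrArg Subtype.val h), fun h => ?_, fun a b hab => ?_⟩
  · exact (mem_maximalIdeal _).mp (natCast_mem_maximalIdeal (B := B) (p := p))
      (by simpa using h.map (coefRing p c).subtype)
  · have key : ∀ y : coefRing p c, (y : B) ∈ maximalIdeal B → (p : coefRing p c) ∣ y := by
      intro y hy
      obtain ⟨z, hz, hyz⟩ := exists_mem_coefRing_eq_natCast_mul hc y.2 hy
      exact ⟨⟨z, hz⟩, Subtype.ext hyz⟩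
    obtain ⟨e, he⟩ := hab
    have h1 : (a : B) * b ∈ maximalIdeal B := by
      have : (a : B) * b = p * e := congrArg Subtype.val he
      rw [this]
      exact Ideal.mul_mem_right _ _ natCast_mem_maximalIdeal
    exact ((maximalIdeal.isMaximal B).isPrime.mem_or_mem h1).imp (key a) (key b)

theorem isNormalCover_coefRing [IsNoetherianRing B] [IsDomain B] [IsPrecomplete (maximalIdeal B) B]
    (hc : IsPBasis p (fun i => residue B (c i))) (h0 : (p : B) ≠ 0) :
    IsNormalCover (coefRing p c).subtype (Ideal.span {(coefRing p c).subtype p}) 1 := by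
  have hp' := prime_natCast_coefRing hc h0
  have hdvr : IsDiscreteValuationRing (coefRing p c) :=
    .ofHasUnitMulPowIrreducibleFactorization
      ⟨p, hp'.irreducible, fun hx => exists_associated_pow_coefRing hc hx⟩
  have hmax : maximalIdeal (coefRing p c) = Ideal.span {(p : coefRing p c)} :=
    hp'.irreducible.maximalIdeal_eq
  refine ⟨inferInstance, inferInstance, inferInstance, inferInstance, ?_, ?_, ?_, fun b => ?_⟩
  · refine isPrecomplete_of_sub_mem fun f hf => ?_
    rw [hmax] at hf ⊢
    simp only [Ideal.span_singleton_pow, Ideal.mem_span_singleton] at hf ⊢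
    have hfB : ∀ n, ((f (n + 1) : coefRing p c) : B) - f n ∈ Ideal.span {(p : B)} ^ n := by
      intro n
      obtain ⟨e, he⟩ := hf n
      rw [Ideal.span_singleton_pow, Ideal.mem_span_singleton]
      exact ⟨e, by simpa using congrArg Subtype.val he⟩
    have hpm : Ideal.span {(p : B)} ≤ maximalIdeal B := by
      rw [Ideal.span_singleton_le_iff_mem]; exact natCast_mem_maximalIdeal
    obtain ⟨L, hL⟩ := IsPrecomplete.exists_sub_mem (maximalIdeal B) (fun n => (f n : B)) fun n =>
      Ideal.pow_right_mono hpm n (hfB n)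
    have hLc : L ∈ coefRing p c := mem_coefRing_of_forall_sub_mem (fun n => (f n).2) hL
    have hle : ∀ n k, n ≤ k → (f k : B) - f n ∈ Ideal.span {(p : B)} ^ n := by
      intro n k hk
      induction k, hk using Nat.le_induction with
      | base => simp
      | succ k hk ih => simpa using add_mem (Ideal.pow_le_pow_right hk (hfB k)) ih
    -- The limit exists only `𝔪`-adically; closedness of the ideal `(p ^ n)` in `B` upgrades it to a
    -- `p`-adic limit, and `hdvd` brings the divisibility back to the coefficient ring.
    have hLp : ∀ n, L - f n ∈ Ideal.span {(p : B)} ^ n := by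
      refine fun n => mem_of_forall_mem_sup_pow fun k => ?_
      rw [← sub_add_sub_cancel L (f (max n k) : B)]
      exact add_mem (Ideal.mem_sup_right (Ideal.pow_le_pow_right (le_max_right n k) (hL _)))
        (Ideal.mem_sup_left (hle _ _ (le_max_left n k)))
    have hdvd : ∀ n, ∀ y : coefRing p c, (y : B) ∈ Ideal.span {(p : B)} ^ n →
        (p : coefRing p c) ^ n ∣ y := by
      intro n
      induction n with
      | zero => simp
      | succ n ih =>
        intro y hy
        rw [Ideal.span_singleton_pow, Ideal.mem_span_singleton] at hy
        obtain ⟨b, hb⟩ := hy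
        obtain ⟨z, hz, hyz⟩ := exists_mem_coefRing_eq_natCast_mul hc y.2 (by
          rw [hb, pow_succ', mul_assoc]
          exact Ideal.mul_mem_right _ _ natCast_mem_maximalIdeal)
        have : y = p * ⟨z, hz⟩ := Subtype.ext hyz
        rw [this, pow_succ']
        refine mul_dvd_mul_left _ (ih _ ?_)
        rw [Ideal.span_singleton_pow, Ideal.mem_span_singleton]
        refine ⟨b, mul_left_cancel₀ h0 ?_⟩
        rw [← hyz, hb, pow_succ', mul_assoc]
    exact ⟨⟨L, hLc⟩, fun n => hdvd n _ (hLp n)⟩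
  · rw [IsDiscreteValuationRing.ringKrullDim_eq_one]; rfl
  · rw [hmax, Ideal.map_span, Set.image_singleton]
  · obtain ⟨r, hr, hbr⟩ := exists_mem_coefRing_sub_mem hc b
    exact ⟨⟨r, hr⟩, hbr⟩

end CoefficientRing

open CoefficientRing in
theorem HasCoefficientRing.of_isAdicComplete.{u} (B : Type u) [CommRing B] [IsLocalRing B]
    [IsDomain B] [IsNoetherianRing B] [IsAdicComplete (maximalIdeal B) B] :
    HasCoefficientRing B := by
  obtain ⟨p, hchar⟩ := CharP.exists (ResidueField B)
  rcases CharP.char_is_prime_or_zero (ResidueField B) p with hp | rfl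
  · have : Fact p.Prime := ⟨hp⟩
    obtain ⟨T, hT⟩ := IsPBasis.exists_isPBasis (ResidueField B) p
    choose σ hσ using residue_surjective (R := B)
    have hc : IsPBasis p fun i : T => residue B (σ i) := by simpa only [hσ] using hT
    refine ⟨coefRing p fun i : T => σ i, inferInstance, (coefRing p fun i : T => σ i).subtype, ?_⟩
    by_cases h0 : (p : B) = 0
    · refine .inl (.of_isField (isField_coefRing hc h0) _ fun b => ?_)
      obtain ⟨r, hr, hbr⟩ := exists_mem_coefRing_sub_mem hc b
      exact ⟨⟨r, hr⟩, hbr⟩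
    · exact .inr ⟨p, prime_natCast_coefRing hc h0, by simpa using h0,
        by simpa using natCast_mem_maximalIdeal (B := B) (p := p), isNormalCover_coefRing hc h0⟩
  · have := CharP.charP_to_charZero (ResidueField B)
    exact .of_charZero B

/-! ### The dimension formula in arbitrary height -/

/-- The dimension formula for complete local domains. -/
theorem ringKrullDim_le_height_add_ringKrullDim_quotient.{u}
    (h : ℕ) (B : Type u) [CommRing B] [IsLocalRing B] [IsDomain B] [IsNoetherianRing B]
    [IsAdicComplete (maximalIdeal B) B] (P : Ideal B) [hP : P.IsPrime] (hh : P.height ≤ h) :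
    ringKrullDim B ≤ ringKrullDim (B ⧸ P) + h := by
  induction h generalizing B with
  | zero =>
    have : P = ⊥ := Ideal.height_eq_zero_iff_eq_bot.mp (by simpa using hh)
    subst this
    rw [ringKrullDim_eq_of_ringEquiv (RingEquiv.quotientBot B)]
    simp
  | succ h ih =>
    by_cases hP0 : P = ⊥
    · subst hP0
      rw [ringKrullDim_eq_of_ringEquiv (RingEquiv.quotientBot B)]
      exact le_add_of_nonneg_right (by positivity)
    obtain ⟨a, haP, ha0⟩ := Submodule.exists_mem_ne_zero_of_ne_bot hP0
    -- A height-one prime inside `P`: the coefficient ring handles `q`, and the induction handles `P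
    -- / q` in the complete domain `B / q`.
    obtain ⟨q, hq, hqP⟩ := Ideal.exists_minimalPrimes_le
      ((Ideal.span_singleton_le_iff_mem P).mpr haP)
    have hqp : q.IsPrime := hq.1.1
    have hq0 : q ≠ ⊥ := by
      rintro rfl
      exact ha0 (by simpa using hq.1.2)
    have hq1 : q.height = 1 := by
      apply le_antisymm (Ideal.height_le_one_of_isPrincipal_of_mem_minimalPrimes _ _ hq)
      rw [Order.one_le_iff_ne_zero]
      rwa [Ne, Ideal.height_eq_zero_iff_eq_bot]
    have : IsLocalRing (B ⧸ q) := .of_surjective' _ Ideal.Quotient.mk_surjective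
    have := isAdicComplete_quotient q
    have hmk := Ideal.Quotient.mk_surjective (I := q)
    have hP' : (P.map (Ideal.Quotient.mk q)).IsPrime :=
      Ideal.map_isPrime_of_surjective hmk (by rwa [Ideal.mk_ker])
    have hht : (P.map (Ideal.Quotient.mk q)).height + 1 ≤ P.height := by
      have := Ideal.height_add_one_le_height_comap_mk hq0 (P.map (Ideal.Quotient.mk q))
      rwa [Ideal.comap_map_of_surjective _ hmk, ← RingHom.ker_eq_comap_bot, Ideal.mk_ker,
        sup_eq_left.mpr hqP] at this
    have h1 := ih (B ⧸ q) (P.map (Ideal.Quotient.mk q)) (by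
      have := hht.trans hh
      rw [Nat.cast_add, Nat.cast_one] at this
      exact (ENat.add_le_add_iff_right ENat.one_ne_top).mp this)
    have h2 := (HasCoefficientRing.of_isAdicComplete B).ringKrullDim_le_of_height_eq_one hq1
    have e : (B ⧸ q) ⧸ P.map (Ideal.Quotient.mk q) ≃+* B ⧸ P :=
      (DoubleQuot.quotQuotEquivQuotOfLE hqP)
    rw [ringKrullDim_eq_of_ringEquiv e] at h1
    refine (h2.trans (add_le_add_left h1 1)).trans (le_of_eq ?_)
    rw [add_assoc]
    rfl

/-! ### Dimension of closed subsets of the spectrum -/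

theorem PrimeSpectrum.topologicalKrullDim_zeroLocus {A : Type*} [CommRing A] (I : Ideal A) :
    topologicalKrullDim (PrimeSpectrum.zeroLocus (I : Set A)) = ringKrullDim (A ⧸ I) := by
  have hemb := PrimeSpectrum.isClosedEmbedding_comap_of_surjective (A ⧸ I) (Ideal.Quotient.mk I)
    Ideal.Quotient.mk_surjective
  have hrange := range_comap_of_surjective (A ⧸ I) (Ideal.Quotient.mk I)
    Ideal.Quotient.mk_surjective
  rw [Ideal.mk_ker] at hrange
  rw [← hrange, ← IsHomeomorph.topologicalKrullDim_eq _
    hemb.isEmbedding.toHomeomorph.isHomeomorph, topologicalKrullDim_eq_ringKrullDim]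

theorem PrimeSpectrum.topologicalKrullDim_eq_krullDim_of_isClosed {A : Type*} [CommRing A]
    {X : Set (PrimeSpectrum A)} (hX : IsClosed X) : topologicalKrullDim X = Order.krullDim X := by
  obtain ⟨I, rfl⟩ := (PrimeSpectrum.isClosed_iff_zeroLocus_ideal X).mp hX
  rw [topologicalKrullDim_zeroLocus, ringKrullDim_quotient]

theorem topologicalKrullDim_mono {T : Type*} [TopologicalSpace T] {X Y : Set T} (h : X ⊆ Y) :
    topologicalKrullDim X ≤ topologicalKrullDim Y :=
  (Topology.IsEmbedding.inclusion h).isInducing.topologicalKrullDim_le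

/-- Closed sets are stable under specialization, so a chain of primes stays in the piece containing
its smallest member. -/
theorem PrimeSpectrum.topologicalKrullDim_iUnion_le {A ι : Type*} [CommRing A]
    {X : ι → Set (PrimeSpectrum A)} (hX : ∀ i, IsClosed (X i)) (hU : IsClosed (⋃ i, X i))
    {n : WithBot ℕ∞} (h : ∀ i, topologicalKrullDim (X i) ≤ n) :
    topologicalKrullDim (⋃ i, X i : Set (PrimeSpectrum A)) ≤ n := by
  rw [topologicalKrullDim_eq_krullDim_of_isClosed hU]
  refine iSup_le fun l => ?_
  obtain ⟨i, hi⟩ := Set.mem_iUnion.mp l.head.2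
  have hl : ∀ j, (l j : PrimeSpectrum A) ∈ X i := fun j =>
    ((PrimeSpectrum.le_iff_specializes _ _).mp (l.head_le j)).mem_closed (hX i) hi
  refine le_trans ?_ (h i)
  rw [topologicalKrullDim_eq_krullDim_of_isClosed (hX i)]
  exact Order.LTSeries.length_le_krullDim (⟨l.length, fun j => ⟨l j, hl j⟩, fun j => l.step j⟩ :
    LTSeries (X i))

theorem Ideal.height_add_ringKrullDim_quotient_le {A : Type*} [CommRing A] {I : Ideal A} {n : ℕ}
    (hn : n ≤ I.height) : ringKrullDim (A ⧸ I) + n ≤ ringKrullDim A := by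
  rw [ringKrullDim_quotient]
  rcases isEmpty_or_nonempty (PrimeSpectrum.zeroLocus (I : Set A)) with h | h
  · rw [Order.krullDim_eq_bot, WithBot.bot_add]
    exact bot_le
  have : Nonempty (PrimeSpectrum A) := h.map Subtype.val
  rw [Order.krullDim_eq_iSup_coheight_of_nonempty, ringKrullDim,
    Order.krullDim_eq_iSup_height_add_coheight_of_nonempty]
  norm_cast
  rw [ENat.iSup_add]
  refine iSup_le fun x => le_iSup_of_le x.1 ?_
  rw [add_comm]
  gcongr
  · rw [← PrimeSpectrum.height_eq_orderHeight]
    exact hn.trans (Ideal.height_mono x.2)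
  · exact Order.coheight_le_coheight_apply_of_strictMono _ (Subtype.strictMono_coe _) x

theorem Ideal.height_map_mk_le {A : Type*} [CommRing A] (p P : Ideal A) [P.IsPrime] (hpP : p ≤ P) :
    (P.map (Ideal.Quotient.mk p)).height ≤ P.height := by
  have hmk := Ideal.Quotient.mk_surjective (I := p)
  have hP' : (P.map (Ideal.Quotient.mk p)).IsPrime :=
    Ideal.map_isPrime_of_surjective hmk (by rwa [Ideal.mk_ker])
  have h1 := Order.height_le_height_apply_of_strictMono (PrimeSpectrum.comap (Ideal.Quotient.mk p))
    (Monotone.strictMono_of_injective (fun a b h => Ideal.comap_mono h)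
      (PrimeSpectrum.comap_injective_of_surjective _ hmk)) ⟨_, hP'⟩
  rw [← PrimeSpectrum.height_eq_orderHeight, ← PrimeSpectrum.height_eq_orderHeight] at h1
  refine h1.trans (le_of_eq ?_)
  congr 1
  rw [PrimeSpectrum.comap_asIdeal, Ideal.comap_map_of_surjective _ hmk, ← RingHom.ker_eq_comap_bot,
    Ideal.mk_ker, sup_eq_left.mpr hpP]

/-- Choose a prime over `I` of the same height and apply the dimension formula in `A / p`, whose
dimension is that of `A` by equidimensionality. -/
theorem IsEquidimensionalRing.ringKrullDim_le_of_height_le {A : Type*} [CommRing A]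
    [IsNoetherianRing A] [IsLocalRing A] [IsAdicComplete (maximalIdeal A) A]
    (hA : IsEquidimensionalRing A) {p I : Ideal A} (hp : p ∈ minimalPrimes A) (hpI : p ≤ I) {t : ℕ}
    (h : I.height ≤ t) : ringKrullDim A ≤ ringKrullDim (A ⧸ I) + t := by
  have hpp : p.IsPrime := hp.1.1
  obtain ⟨n, hn⟩ := ENat.ne_top_iff_exists.mp (ne_top_of_le_ne_top (ENat.natCast_ne_top t) h)
  obtain ⟨P, hP, hIP, hPn⟩ := Ideal.exists_isPrime_height_eq hn.symm
  have hpP := hpI.trans hIP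
  have hmk := Ideal.Quotient.mk_surjective (I := p)
  have : IsLocalRing (A ⧸ p) := .of_surjective' _ hmk
  have := isAdicComplete_quotient p
  have hP' : (P.map (Ideal.Quotient.mk p)).IsPrime :=
    Ideal.map_isPrime_of_surjective hmk (by rwa [Ideal.mk_ker])
  have h1 := ringKrullDim_le_height_add_ringKrullDim_quotient t (A ⧸ p)
    (P.map (Ideal.Quotient.mk p)) ((Ideal.height_map_mk_le p P hpP).trans (by rw [hPn, hn]; exact h))
  rw [hA p hp, ringKrullDim_eq_of_ringEquiv (DoubleQuot.quotQuotEquivQuotOfLE hpP)] at h1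
  refine h1.trans ?_
  gcongr
  exact ringKrullDim_le_of_surjective (Ideal.Quotient.factor hIP)
    (Ideal.Quotient.factor_surjective hIP)

theorem WithBot.le_natCast_of_add_natCast_le {a : WithBot ℕ∞} {m n : ℕ}
    (h : a + n ≤ ((m + n : ℕ) : WithBot ℕ∞)) : a ≤ m := by
  induction a using WithBot.recBotCoe with
  | bot => exact bot_le
  | coe a =>
    induction a using ENat.recTopCoe with
    | top => exact absurd (top_le_iff.mp (WithBot.coe_le_coe.mp h)) (ENat.natCast_ne_top _)
    | coe a =>
      have h' : a + n ≤ m + n := by exact_mod_cast h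
      exact_mod_cast Nat.le_of_add_le_add_right h'

theorem WithBot.lt_natCast_succ_iff {a : WithBot ℕ∞} {m : ℕ} :
    a < ((m + 1 : ℕ) : WithBot ℕ∞) ↔ a ≤ m := by
  induction a using WithBot.recBotCoe with
  | bot => simp [WithBot.bot_lt_iff_ne_bot]
  | coe a =>
    have h := ENat.lt_natCast_add_one_iff (m := a) (n := m)
    exact_mod_cast h

theorem isConnected_of_subsingleton_connectedComponents {T : Type*} [TopologicalSpace T] {s : Set T}
    (hs : s.Nonempty) [Subsingleton (ConnectedComponents s)] : IsConnected s := by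
  refine ⟨hs, isPreconnected_iff_preconnectedSpace.mpr ?_⟩
  rw [preconnectedSpace_iff_connectedComponent]
  intro x
  exact Set.eq_univ_of_forall fun y =>
    ConnectedComponents.coe_eq_coe'.mp (Subsingleton.elim (y : ConnectedComponents s) x)

/-! ### Graph components against components of complements -/

namespace IsEquidimensionalRing

variable {A : Type*} [CommRing A] {d t : ℕ}

theorem notMem_of_topologicalKrullDim_lt (hA : IsEquidimensionalRing A)
    {X : Set (PrimeSpectrum A)} (hX : IsClosed X) (hXd : topologicalKrullDim X < ringKrullDim A)
    {x : PrimeSpectrum A} (hx : x.asIdeal ∈ minimalPrimes A) : x ∉ X := by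
  intro hxX
  have h1 : PrimeSpectrum.zeroLocus (x.asIdeal : Set A) ⊆ X := fun y hy =>
    ((PrimeSpectrum.le_iff_specializes x y).mp hy).mem_closed hX hxX
  have h2 := topologicalKrullDim_mono h1
  rw [PrimeSpectrum.topologicalKrullDim_zeroLocus, hA _ hx] at h2
  exact absurd hXd h2.not_gt

variable [IsNoetherianRing A] [IsLocalRing A] [IsAdicComplete (maximalIdeal A) A]

theorem height_add_le_iff (hA : IsEquidimensionalRing A)
    (hdim : ringKrullDim A = (d : WithBot ℕ∞)) (ht : t < d) (p q : minimalPrimes A) :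
    (p.1 + q.1).height ≤ t ↔
      ¬ ringKrullDim (A ⧸ p.1 + q.1) ≤ ((d - t - 1 : ℕ) : WithBot ℕ∞) := by
  constructor
  · intro h hle
    have h1 := hA.ringKrullDim_le_of_height_le p.2 (I := p.1 + q.1) le_sup_left h
    rw [hdim] at h1
    have h2 : (d : WithBot ℕ∞) ≤ ((d - t - 1 + t : ℕ) : WithBot ℕ∞) := by
      refine h1.trans ?_
      rw [Nat.cast_add]
      gcongr
    have : d ≤ d - t - 1 + t := by exact_mod_cast h2
    omega
  · contrapose!
    intro h
    have h1 : ((t + 1 : ℕ) : ℕ∞) ≤ (p.1 + q.1).height := by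
      rw [Nat.cast_add, Nat.cast_one]
      exact Order.add_one_le_of_lt h
    have h2 := Ideal.height_add_ringKrullDim_quotient_le h1
    rw [hdim] at h2
    refine WithBot.le_natCast_of_add_natCast_le (n := t + 1) (h2.trans (le_of_eq ?_))
    congr 1
    omega

variable {X : Set (PrimeSpectrum A)}

/-- A generization and its specialization share a component. An edge supplies a point of `V(p + q)`
outside `X`, linking `p` to `q`. -/
theorem exists_surjective_connectedComponents (hA : IsEquidimensionalRing A)
    (hdim : ringKrullDim A = (d : WithBot ℕ∞)) (ht : t < d) (hX : IsClosed X)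
    (hXd : topologicalKrullDim X ≤ ((d - t - 1 : ℕ) : WithBot ℕ∞)) :
    ∃ φ : (minimalPrimesGraph A t).ConnectedComponent →
      ConnectedComponents (Xᶜ : Set (PrimeSpectrum A)), Function.Surjective φ := by
  have hlt : topologicalKrullDim X < ringKrullDim A := by
    rw [hdim]
    refine hXd.trans_lt ?_
    exact_mod_cast (by omega : d - t - 1 < d)
  let pt (p : minimalPrimes A) : (Xᶜ : Set (PrimeSpectrum A)) :=
    ⟨⟨p.1, p.2.1.1⟩, hA.notMem_of_topologicalKrullDim_lt hX hlt p.2⟩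
  have hpt : ∀ (p : minimalPrimes A) (x : (Xᶜ : Set (PrimeSpectrum A))), p.1 ≤ x.1.asIdeal →
      (pt p : ConnectedComponents (Xᶜ : Set (PrimeSpectrum A))) = x := by
    intro p x hpx
    have h1 : pt p ⤳ x :=
      (subtype_specializes_iff _ _).mpr ((PrimeSpectrum.le_iff_specializes (pt p).1 x.1).mp hpx)
    exact (h1.map ConnectedComponents.continuous_coe).eq
  have hadj : ∀ p q, (minimalPrimesGraph A t).Adj p q →
      (pt p : ConnectedComponents (Xᶜ : Set (PrimeSpectrum A))) = pt q := by
    rintro p q ⟨-, hpq⟩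
    rw [hA.height_add_le_iff hdim ht] at hpq
    obtain ⟨x, hx, hxX⟩ : ∃ x ∈ PrimeSpectrum.zeroLocus ((p.1 + q.1 : Ideal A) : Set A), x ∉ X := by
      by_contra! hcon
      apply hpq
      rw [← PrimeSpectrum.topologicalKrullDim_zeroLocus]
      exact (topologicalKrullDim_mono hcon).trans hXd
    rw [hpt p ⟨x, hxX⟩ (le_sup_left.trans hx), hpt q ⟨x, hxX⟩ (le_sup_right.trans hx)]
  have hwalk : ∀ p q, (minimalPrimesGraph A t).Walk p q →
      (pt p : ConnectedComponents (Xᶜ : Set (PrimeSpectrum A))) = pt q := by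
    intro p q w
    induction w with
    | nil => rfl
    | cons h _ ih => exact (hadj _ _ h).trans ih
  refine ⟨SimpleGraph.ConnectedComponent.lift (fun p => (pt p : ConnectedComponents _))
    fun p q w _ => hwalk p q w, fun y => ?_⟩
  obtain ⟨x, rfl⟩ := ConnectedComponents.surjective_coe y
  obtain ⟨p, hp, hpx⟩ := Ideal.exists_minimalPrimes_le (I := ⊥) (J := x.1.asIdeal) bot_le
  exact ⟨SimpleGraph.connectedComponentMk _ ⟨p, hp⟩, hpt ⟨p, hp⟩ x hpx⟩

/-- Removing every intersection `V(p) ∩ V(q)` between different graph components separates the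
corresponding unions of irreducible components; non-adjacency bounds the dimension removed. -/
theorem exists_closed_surjective_connectedComponent (hA : IsEquidimensionalRing A)
    (hdim : ringKrullDim A = (d : WithBot ℕ∞)) (ht : t < d) :
    ∃ X : Set (PrimeSpectrum A), IsClosed X ∧
      topologicalKrullDim X ≤ ((d - t - 1 : ℕ) : WithBot ℕ∞) ∧
      ∃ ψ : ConnectedComponents (Xᶜ : Set (PrimeSpectrum A)) →
        (minimalPrimesGraph A t).ConnectedComponent, Function.Surjective ψ := by
  let G := minimalPrimesGraph A t
  have hfin : Finite (minimalPrimes A) := (minimalPrimes.finite_of_isNoetherianRing A).to_subtype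
  let ι := {r : minimalPrimes A × minimalPrimes A //
    G.connectedComponentMk r.1 ≠ G.connectedComponentMk r.2}
  let Z : ι → Set (PrimeSpectrum A) := fun r =>
    PrimeSpectrum.zeroLocus ((r.1.1.1 + r.1.2.1 : Ideal A) : Set A)
  have hZ : ∀ i, IsClosed (Z i) := fun i => PrimeSpectrum.isClosed_zeroLocus _
  have hX : IsClosed (⋃ i, Z i) := isClosed_iUnion_of_finite hZ
  have hXd : topologicalKrullDim (⋃ i, Z i : Set (PrimeSpectrum A)) ≤
      ((d - t - 1 : ℕ) : WithBot ℕ∞) := by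
    refine PrimeSpectrum.topologicalKrullDim_iUnion_le hZ hX fun r => ?_
    rw [PrimeSpectrum.topologicalKrullDim_zeroLocus]
    by_contra hcon
    rw [← hA.height_add_le_iff hdim ht] at hcon
    exact r.2 (SimpleGraph.ConnectedComponent.connectedComponentMk_eq_of_adj
      ⟨fun h => r.2 (congrArg _ h), hcon⟩)
  have hlt : topologicalKrullDim (⋃ i, Z i : Set (PrimeSpectrum A)) < ringKrullDim A := by
    rw [hdim]
    refine hXd.trans_lt ?_
    exact_mod_cast (by omega : d - t - 1 < d)
  refine ⟨_, hX, hXd, ?_⟩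
  let : TopologicalSpace G.ConnectedComponent := ⊥
  have : DiscreteTopology G.ConnectedComponent := ⟨rfl⟩
  choose m hm hmx using fun x : ((⋃ i, Z i)ᶜ : Set (PrimeSpectrum A)) =>
    Ideal.exists_minimalPrimes_le (I := ⊥) (J := x.1.asIdeal) bot_le
  let g : ((⋃ i, Z i)ᶜ : Set (PrimeSpectrum A)) → G.ConnectedComponent := fun x =>
    G.connectedComponentMk ⟨m x, hm x⟩
  have hg : ∀ (x : ((⋃ i, Z i)ᶜ : Set (PrimeSpectrum A))) (p : minimalPrimes A),
      p.1 ≤ x.1.asIdeal → g x = G.connectedComponentMk p := by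
    intro x p hp
    by_contra hne
    exact x.2 (Set.mem_iUnion.mpr ⟨⟨(⟨m x, hm x⟩, p), hne⟩, sup_le (hmx x) hp⟩)
  -- Fibres are finite unions of traces of `V(p)`, so `g` is continuous to a discrete space and
  -- constant on connected components.
  have hclosed : ∀ s : Set G.ConnectedComponent, IsClosed (g ⁻¹' s) := by
    intro s
    have : g ⁻¹' s = ⋃ p : {p : minimalPrimes A // G.connectedComponentMk p ∈ s},
        Subtype.val ⁻¹' PrimeSpectrum.zeroLocus (p.1.1 : Set A) := by
      ext x
      simp only [Set.mem_preimage, Set.mem_iUnion]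
      constructor
      · exact fun hx => ⟨⟨⟨m x, hm x⟩, hx⟩, hmx x⟩
      · rintro ⟨p, hp⟩
        rw [hg x p.1 hp]
        exact p.2
    rw [this]
    exact isClosed_iUnion_of_finite fun p =>
      (PrimeSpectrum.isClosed_zeroLocus _).preimage continuous_subtype_val
  have hcont : Continuous g := continuous_iff_isClosed.mpr fun s _ => hclosed s
  refine ⟨hcont.connectedComponentsLift, fun y => ?_⟩
  obtain ⟨p, rfl⟩ := y.exists_rep
  let x : ((⋃ i, Z i)ᶜ : Set (PrimeSpectrum A)) :=
    ⟨⟨p.1, p.2.1.1⟩, hA.notMem_of_topologicalKrullDim_lt hX hlt p.2⟩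
  exact ⟨x, hg x p le_rfl⟩

theorem isGreatest_card_connectedComponents (hA : IsEquidimensionalRing A)
    (hdim : ringKrullDim A = (d : WithBot ℕ∞)) (ht : t < d) :
    IsGreatest {n : ℕ∞ | ∃ X : Set (PrimeSpectrum A), IsClosed X ∧
        topologicalKrullDim X ≤ ((d - t - 1 : ℕ) : WithBot ℕ∞) ∧
        n = ENat.card (ConnectedComponents (Xᶜ : Set (PrimeSpectrum A)))}
      (ENat.card (minimalPrimesGraph A t).ConnectedComponent) := by
  have hle : ∀ X : Set (PrimeSpectrum A), IsClosed X →
      topologicalKrullDim X ≤ ((d - t - 1 : ℕ) : WithBot ℕ∞) →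
      ENat.card (ConnectedComponents (Xᶜ : Set (PrimeSpectrum A))) ≤
        ENat.card (minimalPrimesGraph A t).ConnectedComponent := fun X hX hXd => by
    obtain ⟨φ, hφ⟩ := hA.exists_surjective_connectedComponents hdim ht hX hXd
    exact ENat.card_le_card_of_injective (Function.injective_surjInv hφ)
  constructor
  · obtain ⟨X, hX, hXd, ψ, hψ⟩ := hA.exists_closed_surjective_connectedComponent hdim ht
    exact ⟨X, hX, hXd, le_antisymm
      (ENat.card_le_card_of_injective (Function.injective_surjInv hψ)) (hle X hX hXd)⟩
  · rintro _ ⟨X, hX, hXd, rfl⟩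
    exact hle X hX hXd

/-- The value `t = 0` is deliberately allowed: the edgeless graph `Γ_0` decides whether `c(A)`
reaches `d`. -/
theorem connected_minimalPrimesGraph_iff (hA : IsEquidimensionalRing A)
    (hdim : ringKrullDim A = (d : WithBot ℕ∞)) (ht : t < d) :
    (minimalPrimesGraph A t).Connected ↔ ((d - t : ℕ) : WithBot ℕ∞) ≤ connectednessDim A := by
  have hdt : d - t = d - t - 1 + 1 := by omega
  have hlt : ∀ X : Set (PrimeSpectrum A), topologicalKrullDim X < ((d - t : ℕ) : WithBot ℕ∞) ↔
      topologicalKrullDim X ≤ ((d - t - 1 : ℕ) : WithBot ℕ∞) := fun X => by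
    rw [← WithBot.lt_natCast_succ_iff, ← hdt]
  constructor
  · intro hG
    obtain ⟨X, hX, hXc, hXd⟩ := (connectednessDim_isLeast A).1
    rw [hXd]
    by_contra! hcon
    rw [hlt] at hcon
    have := hG.preconnected.subsingleton_connectedComponent
    obtain ⟨φ, hφ⟩ := hA.exists_surjective_connectedComponents hdim ht hX hcon
    have := hφ.subsingleton
    obtain ⟨p⟩ := hG.nonempty
    obtain ⟨x, -⟩ := ConnectedComponents.surjective_coe
      (φ ((minimalPrimesGraph A t).connectedComponentMk p))
    exact hXc (isConnected_of_subsingleton_connectedComponents ⟨x.1, x.2⟩)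
  · intro hc
    obtain ⟨X, hX, hXd, ψ, hψ⟩ := hA.exists_closed_surjective_connectedComponent hdim ht
    have hconn : IsConnected Xᶜ := by
      by_contra hcon
      have h1 := hc.trans ((connectednessDim_isLeast A).2 ⟨X, hX, hcon, rfl⟩)
      exact h1.not_gt ((hlt X).mpr hXd)
    have := isPreconnected_iff_preconnectedSpace.mp hconn.isPreconnected
    have := hψ.subsingleton
    obtain ⟨p, hp, -⟩ := Ideal.exists_minimalPrimes_le (I := ⊥) (J := maximalIdeal A) bot_le
    have : Nonempty (minimalPrimes A) := ⟨⟨p, hp⟩⟩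
    exact ⟨fun p q => SimpleGraph.ConnectedComponent.exact (Subsingleton.elim _ _)⟩

end IsEquidimensionalRing

/-! ### Bounds on the connectedness dimension and the final statement -/

theorem Ideal.eq_of_height_add_eq_zero {A : Type*} [CommRing A] {p q : Ideal A}
    (hp : p ∈ minimalPrimes A) (hq : q ∈ minimalPrimes A) (h : (p + q).height = 0) : p = q := by
  obtain ⟨P, hP, hle, hP0⟩ := Ideal.exists_isPrime_height_eq (n := 0) h
  have hPmin : P ∈ minimalPrimes A := Ideal.height_eq_zero_iff.mp hP0
  have hpP : p ≤ P := le_sup_left.trans hle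
  have hqP : q ≤ P := le_sup_right.trans hle
  rw [le_antisymm hpP (hPmin.2 hp.1 hpP), le_antisymm hqP (hPmin.2 hq.1 hqP)]

/-- Only `X = ∅` has dimension `⊥`, and it does not disconnect: in a local ring every point
specializes to the closed point. -/
theorem zero_le_connectednessDim (A : Type*) [CommRing A] [IsLocalRing A] :
    0 ≤ connectednessDim A := by
  obtain ⟨X, hX, hXc, hXd⟩ := (connectednessDim_isLeast A).1
  rw [hXd]
  rcases X.eq_empty_or_nonempty with rfl | hne
  · refine absurd ⟨⟨closedPoint A, Set.notMem_empty _⟩, ?_⟩ hXc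
    rw [Set.compl_empty]
    refine isPreconnected_of_forall (closedPoint A) fun y _ => ⟨closure {y}, Set.subset_univ _,
      specializes_iff_mem_closure.mp (specializes_closedPoint y), subset_closure rfl,
      isPreconnected_singleton.closure⟩
  · have := hne.to_subtype
    rw [PrimeSpectrum.topologicalKrullDim_eq_krullDim_of_isClosed hX]
    exact Order.krullDim_nonneg

theorem connectednessDim_le_ringKrullDim (A : Type*) [CommRing A] :
    connectednessDim A ≤ ringKrullDim A := by
  refine (connectednessDim_isLeast A).2 ⟨Set.univ, isClosed_univ, by simp [IsConnected], ?_⟩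
  rw [← PrimeSpectrum.topologicalKrullDim_eq_ringKrullDim]
  exact (IsHomeomorph.topologicalKrullDim_eq _ (Homeomorph.Set.univ _).isHomeomorph).symm

theorem proposition2p2 {A : Type*} [CommRing A] [IsNoetherianRing A] [IsLocalRing A]
    [IsAdicComplete (IsLocalRing.maximalIdeal A) A] (hA : IsEquidimensionalRing A)
    (d : ℕ) (hd : 2 ≤ d) (hdim : ringKrullDim A = (d : WithBot ℕ∞)) :
    (∀ t : ℕ, 1 ≤ t → t ≤ d - 1 →
      ((minimalPrimesGraph A t).Connected ↔ ((d - t : ℕ) : WithBot ℕ∞) ≤ connectednessDim A) ∧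
      IsGreatest
        {n : ℕ∞ | ∃ X : Set (PrimeSpectrum A), IsClosed X ∧
          topologicalKrullDim X ≤ ((d - t - 1 : ℕ) : WithBot ℕ∞) ∧
          n = ENat.card (ConnectedComponents (Xᶜ : Set (PrimeSpectrum A)))}
        (ENat.card (minimalPrimesGraph A t).ConnectedComponent)) ∧
    ((minimalPrimes A).Nontrivial →
      IsGreatest
        ((fun i : ℕ => (i : WithBot ℕ∞)) ''
          {i : ℕ | i = 0 ∨ (1 ≤ i ∧ i ≤ d - 1 ∧ (minimalPrimesGraph A (d - i)).Connected)})
        (connectednessDim A)) ∧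
    ((minimalPrimes A).Subsingleton → connectednessDim A = (d : WithBot ℕ∞)) := by
  have hconn : ∀ i : ℕ, 1 ≤ i → i ≤ d →
      ((minimalPrimesGraph A (d - i)).Connected ↔ (i : WithBot ℕ∞) ≤ connectednessDim A) :=
    fun i hi hid => by
      rw [hA.connected_minimalPrimesGraph_iff hdim (by omega), Nat.sub_sub_self hid]
  refine ⟨fun t _ ht' => ⟨hA.connected_minimalPrimesGraph_iff hdim (by omega),
    hA.isGreatest_card_connectedComponents hdim (by omega)⟩, fun hnt => ⟨?_, ?_⟩, fun hss => ?_⟩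
  -- If `c(A) ≥ d`, then `Γ_0` would be connected with at least two vertices, yet an edge of `Γ_0`
  -- would identify its two endpoints.
  · have hlt : connectednessDim A < ((d : ℕ) : WithBot ℕ∞) := by
      by_contra! hcon
      rw [← hconn d (by omega) le_rfl, Nat.sub_self] at hcon
      have : Nontrivial (minimalPrimes A) := hnt.coe_sort
      obtain ⟨p⟩ := hcon.nonempty
      obtain ⟨q, hpq, hq⟩ := hcon.preconnected.exists_adj_of_nontrivial p
      exact hpq (Subtype.ext (Ideal.eq_of_height_add_eq_zero p.2 q.2 (by simpa using hq)))
    obtain ⟨i, hi⟩ : ∃ i : ℕ, connectednessDim A = i := by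
      have h0 := zero_le_connectednessDim A
      revert h0 hlt
      generalize connectednessDim A = c
      intro hlt h0
      induction c using WithBot.recBotCoe with
      | bot => simp at h0
      | coe c =>
        induction c using ENat.recTopCoe with
        | top => exact absurd hlt (by simp)
        | coe c => exact ⟨c, rfl⟩
    rw [hi] at hlt
    have hid : i < d := by exact_mod_cast hlt
    refine ⟨i, ?_, hi.symm⟩
    rcases Nat.eq_zero_or_pos i with rfl | hpos
    · exact .inl rfl
    · exact .inr ⟨hpos, by omega, (hconn i hpos hid.le).mpr hi.ge⟩
  · rintro _ ⟨i, rfl | ⟨hi, hid, hG⟩, rfl⟩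
    · exact zero_le_connectednessDim A
    · exact (hconn i hi (by omega)).mp hG
  · refine le_antisymm (hdim ▸ connectednessDim_le_ringKrullDim A)
      ((hconn d (by omega) le_rfl).mp ?_)
    have : Subsingleton (minimalPrimes A) := hss.coe_sort
    obtain ⟨p, hp, -⟩ := Ideal.exists_minimalPrimes_le (I := ⊥) (J := maximalIdeal A) bot_le
    have : Nonempty (minimalPrimes A) := ⟨⟨p, hp⟩⟩
    exact ⟨.of_subsingleton⟩
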